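/- Let $\gamma>2$. For $m\in L^1(\mathbb R)$ (complex valued) put $\widehat m(k)=\int_{\mathbb R}m(x)e^{-ikx}\,dx$, extended to tempered distributions in the usual way; for $\beta\in\mathbb R$ let $L^2_\beta=L^2(\mathbb R;e^{-\beta k}dk)$, $\|f\|_{L^2_\beta}^2=\int_{\mathbb R}|f(k)|^2e^{-\beta k}\,dk$; and let $\exp$ denote the function $k\mapsto e^k$. Define $$M_\gamma=\inf_{m}\ \|m\|_{L^1}^{\gamma-2}\,\|\widehat m-\exp\|_{L^2_\gamma}^2 ,$$ where the infimum is over all $m\in L^1(\mathbb R)$ with $\widehat m-\exp\in L^2_\gamma$ (for other $m\in L^1(\mathbb R)$ the functional is $+\infty$). 1. The infimum is attained. The minimizer is unique up to the transformations $m(x)\mapsto m(x)\,\alpha^{-ix-1}$, $\alpha>0$: if $m$ is a minimizer, then the minimizers are exactly the functions $x\mapsto m(x)\,\alpha^{-ix-1}$ with $\alpha>0$ (as elements of $L^1(\mathbb R)$). 2. For every $g\in C_0(\mathbb R)$ (continuous, complex valued, vanishing at infinity) whose distributional Fourier transform $\widehat g$ is a function in $L^2_{-\gamma}$, the limit $$\langle\exp,\widehat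 g\rangle:=\lim_{\varepsilon\downarrow0}\int_{\mathbb R}\varphi(\varepsilon k)\,\widehat g(k)\,e^k\,dk,\qquad \varphi\in C_c^\infty(\mathbb R),\ \varphi(0)=1,$$ exists in $\mathbb C$ and does not depend on $\varphi$, and $$M_\gamma=\frac{4(\gamma-2)^{\gamma-2}}{(2\pi)^{\gamma-2}\gamma^\gamma}\ \sup_{\substack{0\neq g\in C_0(\mathbb R)\\ \widehat g\in L^2_{-\gamma}}}\ \frac{|\langle\exp,\widehat g\rangle|^{\gamma}}{\|g\|_{L^\infty}^{\gamma-2}\,\|\widehat g\|_{L^2_{-\gamma}}^2},$$ where the supremum is finite. -/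

import Mathlib

open MeasureTheory Filter Topology
open scoped ENNReal ContDiff ZeroAtInfty

namespace PrimalOptimizer

noncomputable section

/-- The measure `e^{-γ k} dk` on `ℝ`. -/
def expWeight (γ : ℝ) : Measure ℝ :=
  (volume : Measure ℝ).withDensity fun k => ENNReal.ofReal (Real.exp (-γ * k))

/-- Membership in the exponentially weighted space `L²_γ(ℝ) = L²(ℝ; e^{-γ k} dk)`. -/
def MemL2 (γ : ℝ) (f : ℝ → ℂ) : Prop :=
  MemLp f 2 (expWeight γ)

/-- The norm of `L²_γ(ℝ)` (meaningful for `f` with `MemL2 γ f`). -/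
def normL2 (γ : ℝ) (f : ℝ → ℂ) : ℝ :=
  (eLpNorm f 2 (expWeight γ)).toReal

/-- The Fourier transform `k ↦ ∫ f(x) e^{-ikx} dx`. -/
def fourier (f : ℝ → ℂ) (k : ℝ) : ℂ :=
  ∫ x : ℝ, f x * Complex.exp (-(Complex.I * (k : ℂ) * (x : ℂ)))

/-- The real exponential function, as a complex valued function. -/
def expFun (k : ℝ) : ℂ := (Real.exp k : ℂ)

/-- The complex Lebesgue space `L¹(ℝ)`. -/
abbrev L1 : Type := Lp ℂ 1 (volume : Measure ℝ)

/-- The effective domain: all `m ∈ L¹(ℝ)` with `m̂ - exp ∈ L²_γ(ℝ)`. -/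
def primalDomain (γ : ℝ) : Set L1 :=
  {m | MemL2 γ fun k => fourier m k - expFun k}

/-- The primal functional `‖m‖₁^{γ-2} ‖m̂ - exp‖²_{L²_γ}`, for `m` in the effective domain. -/
def primalFunctional (γ : ℝ) (m : L1) : ℝ :=
  ‖m‖ ^ (γ - 2) * normL2 γ (fun k => fourier m k - expFun k) ^ 2

/-- The number `M_γ`. Outside the effective domain the functional has the value `+∞`, so the
infimum over `L¹(ℝ)` is the infimum over the effective domain. -/
def primalInf (γ : ℝ) : ℝ :=
  sInf (primalFunctional γ '' primalDomain γ)

/-- `m` is a minimizer of the primal problem. -/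
def IsPrimalMinimizer (γ : ℝ) (m : L1) : Prop :=
  m ∈ primalDomain γ ∧ primalFunctional γ m = primalInf γ

/-- Complex valued test functions, `C_c^∞(ℝ)`. -/
def IsTestFunction (φ : ℝ → ℂ) : Prop :=
  ContDiff ℝ ∞ φ ∧ HasCompactSupport φ

/-- The distributional Fourier transform of the bounded function `g` is the locally integrable
function `u`: `∫ u φ = ∫ g φ̂` for all test functions `φ`. (As `u` may grow exponentially, it is
tested against `C_c^∞(ℝ)`, which is dense in the Schwartz space.) -/
def HasFourierTransform (g u : ℝ → ℂ) : Prop :=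
  LocallyIntegrable u ∧
    ∀ φ : ℝ → ℂ, IsTestFunction φ → ∫ k : ℝ, u k * φ k = ∫ x : ℝ, g x * fourier φ x

/-- `g ∈ C₀(ℝ)` has a Fourier transform in `L²_{-γ}(ℝ)`, given by the function `u`. -/
def IsDualAdmissible (γ : ℝ) (g : C₀(ℝ, ℂ)) (u : ℝ → ℂ) : Prop :=
  HasFourierTransform g u ∧ MemL2 (-γ) u

/-- `⟨exp, u⟩ = z`, as a regularized integral: `∫ φ(εk) u(k) e^k dk → z` as `ε ↓ 0`, for every
test function `φ` with `φ(0) = 1`. -/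
def HasExpPairing (u : ℝ → ℂ) (z : ℂ) : Prop :=
  ∀ φ : ℝ → ℂ, IsTestFunction φ → φ 0 = 1 →
    Tendsto (fun ε : ℝ => ∫ k : ℝ, φ (ε * k) * u k * expFun k) (𝓝[>] 0) (𝓝 z)

/-- The values `|⟨exp, ĝ⟩|^γ / (‖g‖_∞^{γ-2} ‖ĝ‖²_{L²_{-γ}})` of the dual functional, for nonzero
`g ∈ C₀(ℝ)` with `ĝ ∈ L²_{-γ}(ℝ)`. The norm of `C₀(ℝ, ℂ)` is the supremum norm. -/
def dualValues (γ : ℝ) : Set ℝ :=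
  {r | ∃ (g : C₀(ℝ, ℂ)) (u : ℝ → ℂ) (z : ℂ), g ≠ 0 ∧ IsDualAdmissible γ g u ∧
    HasExpPairing u z ∧ r = ‖z‖ ^ γ / (‖g‖ ^ (γ - 2) * normL2 (-γ) u ^ 2)}

end

end PrimalOptimizer

open PrimalOptimizer

namespace PrimalOptimizer

/-! ### Exponentially weighted spaces -/

/-! The proof is a sandwich between weak and strong convex duality, and strong duality produces the
minimizer.

Weak duality. If `m` is in the effective domain, write exp = m̂ − (m̂ − exp). Pairing with ĝ gives
⟨exp, ĝ⟩ = 2π ∫ m(y) g(−y) dy − ∫ ĝ (m̂ − exp), so the regularized limit exists and |⟨exp, ĝ⟩| ≤ 2π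
‖m‖ ‖g‖ + ‖m̂ − exp‖ ‖ĝ‖. The transformation m ↦ m α^{−ix−1} shifts m̂ by log α, multiplies it by
1/α and fixes exp; the two terms become multiples of α⁻¹ and α^{γ/2−1} while the left side does not
change. Optimizing in α turns the sum into the product occurring in the functional
(`norm_rpow_expPairing_le`).

Strong duality. Let D be the dual supremum. On the pairs (g, ĝ) in C₀ × L²_{−γ} with the maximum
norm, ⟨exp, ĝ⟩ is a functional of norm at most D^{1/γ} (`norm_expPairing_le_sSup`). A Hahn–Banach
extension splits into a complex measure and some w in L²_γ, with the sum of the two norms at most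
D^{1/γ}. Testing with C_c^∞ shows that the normalized transform of the measure is exp − w. It decays
exponentially on a half-line, so a theorem of F. and M. Riesz type (`exists_L1_density`) makes the
measure an L¹ function `m`, with m̂ − exp = −w (`exists_mem_primalDomain`). The weighted inequality
of means (`rpow_mul_sq_le`) bounds its value by the same constant times D. Hence `m` is a minimizer
and there is no duality gap.

Uniqueness. Scaling reduces to two minimizers of equal L¹ norm; strict convexity of the Hilbert norm
then gives m̂ = m̂′ (`IsPrimalMinimizer.eq_of_norm_eq`). -/

theorem expWeight_absolutelyContinuous (γ : ℝ) : expWeight γ ≪ volume :=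
  withDensity_absolutelyContinuous _ _

theorem absolutelyContinuous_expWeight (γ : ℝ) : volume ≪ expWeight γ :=
  withDensity_absolutelyContinuous' (by fun_prop) (Eventually.of_forall fun k => by
    simp [Real.exp_pos])

theorem aestronglyMeasurable_expWeight_iff {γ : ℝ} {f : ℝ → ℂ} :
    AEStronglyMeasurable f (expWeight γ) ↔ AEStronglyMeasurable f volume :=
  ⟨fun h => h.mono_ac (absolutelyContinuous_expWeight γ),
    fun h => h.mono_ac (expWeight_absolutelyContinuous γ)⟩

/-- The isometry from `L²_γ` to the unweighted space. -/
theorem eLpNorm_expWeight (γ : ℝ) (f : ℝ → ℂ) :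
    eLpNorm f 2 (expWeight γ) =
      eLpNorm (fun k => (Real.exp (-γ * k / 2) : ℂ) * f k) 2 volume := by
  rw [eLpNorm_eq_lintegral_rpow_enorm_toReal (by simp) (by simp),
    eLpNorm_eq_lintegral_rpow_enorm_toReal (by simp) (by simp), expWeight,
    lintegral_withDensity_eq_lintegral_mul_non_measurable _ (by fun_prop)
      (Eventually.of_forall fun _ => ENNReal.ofReal_lt_top)]
  congr 1
  refine lintegral_congr fun k => ?_
  have h1 : ‖(Real.exp (-γ * k / 2) : ℂ)‖ₑ = ENNReal.ofReal (Real.exp (-γ * k / 2)) := by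
    rw [← ofReal_norm, Complex.norm_real, Real.norm_eq_abs, Real.abs_exp]
  simp only [Pi.mul_apply, enorm_mul, h1, ENNReal.toReal_ofNat, ENNReal.rpow_ofNat, mul_pow]
  rw [← ENNReal.ofReal_pow (Real.exp_pos _).le, ← Real.exp_nat_mul]
  congr 3
  push_cast
  ring

theorem memL2_iff {γ : ℝ} {f : ℝ → ℂ} :
    MemL2 γ f ↔ MemLp (fun k => (Real.exp (-γ * k / 2) : ℂ) * f k) 2 volume := by
  unfold MemL2 MemLp
  rw [eLpNorm_expWeight, aestronglyMeasurable_expWeight_iff]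
  refine and_congr_left fun _ => ⟨fun h => (by fun_prop : Continuous fun k : ℝ =>
    (Real.exp (-γ * k / 2) : ℂ)).aestronglyMeasurable.mul h, fun h => ?_⟩
  refine ((by fun_prop : Continuous fun k : ℝ =>
    (Real.exp (γ * k / 2) : ℂ)).aestronglyMeasurable.mul h).congr
      (Eventually.of_forall fun k => ?_)
  simp only [Pi.mul_apply, ← mul_assoc, ← Complex.ofReal_mul, ← Real.exp_add]
  rw [show γ * k / 2 + -γ * k / 2 = 0 by ring]
  simp

theorem normL2_nonneg (γ : ℝ) (f : ℝ → ℂ) : 0 ≤ normL2 γ f := ENNReal.toReal_nonneg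

theorem MemL2.aestronglyMeasurable {γ : ℝ} {f : ℝ → ℂ} (h : MemL2 γ f) :
    AEStronglyMeasurable f volume :=
  aestronglyMeasurable_expWeight_iff.1 h.1

theorem MemL2.congr_ae {γ : ℝ} {f g : ℝ → ℂ} (h : MemL2 γ f) (hfg : f =ᵐ[volume] g) :
    MemL2 γ g :=
  MemLp.ae_eq ((expWeight_absolutelyContinuous γ).ae_eq hfg) h

theorem normL2_congr_ae {γ : ℝ} {f g : ℝ → ℂ} (hfg : f =ᵐ[volume] g) :
    normL2 γ f = normL2 γ g := by
  unfold normL2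
  rw [eLpNorm_congr_ae ((expWeight_absolutelyContinuous γ).ae_eq hfg)]

/-- The weights of L²_{−γ} and L²_γ are reciprocal, so the unweighted integral ∫ u w is the duality
pairing of the two spaces. -/
theorem exp_mul_exp_cancel (γ k : ℝ) (a b : ℂ) :
    ((Real.exp (-(-γ) * k / 2) : ℂ) * a) * ((Real.exp (-γ * k / 2) : ℂ) * b) = a * b := by
  have : (Real.exp (-(-γ) * k / 2) : ℂ) * (Real.exp (-γ * k / 2) : ℂ) = 1 := by
    rw [← Complex.ofReal_mul, ← Real.exp_add, show -(-γ) * k / 2 + -γ * k / 2 = 0 by ring]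
    simp
  linear_combination a * b * this

theorem MemL2.integrable_mul {γ : ℝ} {u w : ℝ → ℂ} (hu : MemL2 (-γ) u) (hw : MemL2 γ w) :
    Integrable fun k => u k * w k := by
  have := MemLp.integrable_mul (memL2_iff.1 hu) (memL2_iff.1 hw)
  refine this.congr (Eventually.of_forall fun k => ?_)
  exact exp_mul_exp_cancel γ k _ _

theorem MemL2.norm_integral_mul_le {γ : ℝ} {u w : ℝ → ℂ} (hu : MemL2 (-γ) u)
    (hw : MemL2 γ w) : ‖∫ k, u k * w k‖ ≤ normL2 (-γ) u * normL2 γ w := by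
  have hu' := memL2_iff.1 hu
  have hw' := memL2_iff.1 hw
  have h1 := eLpNorm_smul_le_mul_eLpNorm (p := 2) (q := 2) (r := 1) hw'.1 hu'.1
  have h2 : ‖∫ k, u k * w k‖ ≤ (eLpNorm (fun k => u k * w k) 1 volume).toReal := by
    refine (norm_integral_le_integral_norm _).trans_eq ?_
    rw [integral_norm_eq_lintegral_enorm (hu.integrable_mul hw).1, eLpNorm_one_eq_lintegral_enorm]
  refine h2.trans ?_
  unfold normL2
  rw [← ENNReal.toReal_mul, eLpNorm_expWeight, eLpNorm_expWeight]
  refine ENNReal.toReal_mono (ENNReal.mul_ne_top hu'.2.ne hw'.2.ne) ?_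
  refine le_trans (le_of_eq ?_) h1
  congr 1
  funext k
  exact (exp_mul_exp_cancel γ k _ _).symm

theorem MemL2.locallyIntegrable {γ : ℝ} {u : ℝ → ℂ} (hu : MemL2 γ u) :
    LocallyIntegrable u := by
  have h := (memL2_iff.1 hu).locallyIntegrable (by norm_num)
  have h2 := LocallyIntegrableOn.continuousOn_smul isClosed_univ.isLocallyClosed
    (locallyIntegrableOn_univ.2 h)
    (g := fun k : ℝ => (Real.exp (γ * k / 2) : ℂ)) (by fun_prop)
  rw [locallyIntegrableOn_univ] at h2
  refine h2.congr (Eventually.of_forall fun k => ?_)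
  simp only [smul_eq_mul, ← mul_assoc, ← Complex.ofReal_mul, ← Real.exp_add]
  rw [show γ * k / 2 + -γ * k / 2 = 0 by ring]
  simp

/-! ### The Fourier transform -/

theorem fourier_eq (f : ℝ → ℂ) (k : ℝ) :
    fourier f k = FourierTransform.fourier f (k / (2 * Real.pi)) := by
  rw [Real.fourier_real_eq_integral_exp_smul, fourier]
  refine integral_congr_ae (Eventually.of_forall fun x => ?_)
  simp only [smul_eq_mul]
  rw [mul_comm]
  congr 2
  have : (Real.pi : ℂ) ≠ 0 := by exact_mod_cast Real.pi_ne_zero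
  push_cast
  field_simp

theorem norm_cexp_neg_I_mul (k x : ℝ) : ‖Complex.exp (-(Complex.I * k * x))‖ = 1 := by
  rw [show -(Complex.I * k * x) = ((-(k * x) : ℝ) : ℂ) * Complex.I by push_cast; ring]
  exact Complex.norm_exp_ofReal_mul_I _

theorem norm_cexp_I_mul (k x : ℝ) : ‖Complex.exp (Complex.I * k * x)‖ = 1 := by
  rw [show Complex.I * k * x = (((k * x) : ℝ) : ℂ) * Complex.I by push_cast; ring]
  exact Complex.norm_exp_ofReal_mul_I _

theorem norm_fourier_le (f : ℝ → ℂ) (k : ℝ) : ‖fourier f k‖ ≤ ∫ x, ‖f x‖ := by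
  refine (norm_integral_le_integral_norm _).trans_eq ?_
  simp [norm_cexp_neg_I_mul]

theorem fourier_congr_ae {f g : ℝ → ℂ} (h : f =ᵐ[volume] g) : fourier f = fourier g := by
  funext k
  refine integral_congr_ae ?_
  filter_upwards [h] with x hx
  rw [hx]

theorem integrable_mul_cexp {f : ℝ → ℂ} {μ : Measure ℝ} (hf : Integrable f μ) (k : ℝ) :
    Integrable (fun x : ℝ => f x * Complex.exp (-(Complex.I * k * x))) μ := by
  refine hf.mul_bdd (c := 1) (by fun_prop) (Eventually.of_forall fun x => ?_)
  rw [norm_cexp_neg_I_mul]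

theorem continuous_integral_mul_cexp {f : ℝ → ℂ} {μ : Measure ℝ} (hf : Integrable f μ) :
    Continuous fun k : ℝ => ∫ x, f x * Complex.exp (-(Complex.I * k * x)) ∂μ := by
  refine continuous_of_dominated (bound := fun x => ‖f x‖)
    (fun k => (integrable_mul_cexp hf k).1) (fun k => Eventually.of_forall fun x => ?_) hf.norm
    (Eventually.of_forall fun x => by fun_prop)
  simp [norm_cexp_neg_I_mul]

theorem continuous_fourier {f : ℝ → ℂ} (hf : Integrable f) : Continuous (fourier f) :=
  continuous_integral_mul_cexp hf

/-- Fubini's theorem for the Fourier transform of the complex measure `h ν`. -/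
theorem integral_integral_mul_cexp_mul {ν : Measure ℝ} [SFinite ν] {h φ : ℝ → ℂ}
    (hh : Integrable h ν) (hφ : Integrable φ) :
    ∫ k : ℝ, (∫ x, h x * Complex.exp (-(Complex.I * k * x)) ∂ν) * φ k =
      ∫ x, h x * fourier φ x ∂ν := by
  have hint : Integrable (Function.uncurry fun (k : ℝ) (x : ℝ) =>
      h x * Complex.exp (-(Complex.I * k * x)) * φ k) ((volume : Measure ℝ).prod ν) := by
    have h1 := hφ.mul_prod hh
    refine (h1.mul_bdd (c := 1) (g := fun p : ℝ × ℝ => Complex.exp (-(Complex.I * p.1 * p.2)))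
      (by fun_prop) (Eventually.of_forall fun p => ?_)).congr (Eventually.of_forall fun p => ?_)
    · rw [norm_cexp_neg_I_mul]
    · simp only [Function.uncurry]; ring
  simp_rw [← integral_mul_const]
  rw [integral_integral_swap hint]
  refine integral_congr_ae (Eventually.of_forall fun x => ?_)
  simp only [fourier, ← integral_const_mul]
  refine integral_congr_ae (Eventually.of_forall fun k => ?_)
  simp only
  rw [show Complex.I * (x : ℂ) * k = Complex.I * k * x by ring]
  ring

theorem integral_fourier_mul {f φ : ℝ → ℂ} (hf : Integrable f) (hφ : Integrable φ) :
    ∫ k, fourier f k * φ k = ∫ x, f x * fourier φ x :=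
  integral_integral_mul_cexp_mul hf hφ

theorem integrable_fourier_comp_mul {f : ℝ → ℂ} (h : Integrable (fourier f)) :
    Integrable (FourierTransform.fourier f) := by
  have := h.comp_mul_right' (R := 2 * Real.pi) (by positivity)
  refine this.congr (Eventually.of_forall fun k => ?_)
  simp only [fourier_eq]
  field_simp

/-- Fourier inversion. -/
theorem fourier_fourier_neg {f : ℝ → ℂ} (hc : Continuous f) (hf : Integrable f)
    (hf' : Integrable (fourier f)) (k : ℝ) :
    fourier (fun x => (2 * Real.pi : ℂ)⁻¹ * fourier f (-x)) k = f k := by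
  have h := congrFun (hc.fourier_fourierInv_eq hf (integrable_fourier_comp_mul hf')) k
  set F : ℝ → ℂ := fun x => fourier f (-x) * Complex.exp (-(Complex.I * k * x)) with hF
  have h2 := Measure.integral_comp_mul_right F (2 * Real.pi)
  rw [abs_of_pos (by positivity)] at h2
  calc fourier (fun x => (2 * Real.pi : ℂ)⁻¹ * fourier f (-x)) k
      = ((2 * Real.pi)⁻¹ : ℝ) • ∫ x, F x := by
        simp only [fourier, hF, mul_assoc, integral_const_mul, Complex.real_smul]
        push_cast
        rfl
    _ = ∫ x, F (x * (2 * Real.pi)) := h2.symm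
    _ = f k := by
        rw [← h, Real.fourier_real_eq_integral_exp_smul]
        refine integral_congr_ae (Eventually.of_forall fun x => ?_)
        simp only [hF, smul_eq_mul, Real.fourierInv_eq_fourier_neg, fourier_eq]
        rw [mul_comm]
        congr 2
        · push_cast; ring
        · field_simp

/-- Evaluation of the inversion formula at the origin. -/
theorem integral_fourier {f : ℝ → ℂ} (hc : Continuous f) (hf : Integrable f)
    (hf' : Integrable (fourier f)) : ∫ x, fourier f x = 2 * Real.pi * f 0 := by
  have h := fourier_fourier_neg hc hf hf' 0
  rw [← h, fourier]
  simp only [Complex.ofReal_zero, mul_zero, zero_mul, neg_zero, Complex.exp_zero, mul_one,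
    integral_const_mul]
  rw [integral_neg_eq_self (fun x => fourier f x)]
  have : (Real.pi : ℂ) ≠ 0 := by exact_mod_cast Real.pi_ne_zero
  field_simp

/-! ### Test functions -/

theorem IsTestFunction.continuous {φ : ℝ → ℂ} (h : IsTestFunction φ) : Continuous φ :=
  h.1.continuous

theorem IsTestFunction.integrable {φ : ℝ → ℂ} (h : IsTestFunction φ) : Integrable φ :=
  h.continuous.integrable_of_hasCompactSupport h.2

theorem IsTestFunction.integrable_fourier {φ : ℝ → ℂ} (h : IsTestFunction φ) :
    Integrable (fourier φ) := by
  have h1 : Integrable (FourierTransform.fourier (h.2.toSchwartzMap h.1 : ℝ → ℂ)) := by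
    rw [← SchwartzMap.fourier_coe]
    exact SchwartzMap.integrable _
  have h2 := h1.comp_div (R := 2 * Real.pi) (by positivity)
  refine h2.congr (Eventually.of_forall fun k => ?_)
  rw [fourier_eq]
  rfl

theorem exists_isTestFunction_eq_one : ∃ φ : ℝ → ℂ, IsTestFunction φ ∧ φ 0 = 1 := by
  let b : ContDiffBump (0 : ℝ) := ⟨1, 2, by norm_num, by norm_num⟩
  refine ⟨fun x => (b x : ℂ), ⟨Complex.ofRealCLM.contDiff.comp b.contDiff, ?_⟩, ?_⟩
  · exact b.hasCompactSupport.comp_left (g := fun x : ℝ => (x : ℂ)) (by simp)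
  · have : b 0 = 1 := b.one_of_mem_closedBall (by simp [b.rIn_pos.le])
    simp [this]

/-- The Fourier transform is injective on integrable functions. -/
theorem ae_eq_zero_of_fourier_ae_eq_zero {f : ℝ → ℂ} (hf : Integrable f)
    (h0 : fourier f =ᵐ[volume] 0) : f =ᵐ[volume] 0 := by
  refine ae_eq_zero_of_integral_contDiff_smul_eq_zero hf.locallyIntegrable fun g hg hg' => ?_
  have hφ : IsTestFunction fun x => (g x : ℂ) :=
    ⟨Complex.ofRealCLM.contDiff.comp hg, hg'.comp_left (g := fun x : ℝ => (x : ℂ)) (by simp)⟩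
  -- Every test function is the transform of an integrable function, so integrating `f` against it
  -- moves the transform onto `f`.
  have h1 := integral_fourier_mul hf
    ((hφ.integrable_fourier.comp_neg).const_mul (2 * Real.pi : ℂ)⁻¹)
  have h2 : fourier (fun x => (2 * Real.pi : ℂ)⁻¹ * fourier (fun x => (g x : ℂ)) (-x)) =
      fun x => (g x : ℂ) :=
    funext fun k => fourier_fourier_neg hφ.continuous hφ.integrable hφ.integrable_fourier k
  rw [h2] at h1
  calc ∫ x, g x • f x = ∫ x, f x * (g x : ℂ) := by
        refine integral_congr_ae (Eventually.of_forall fun x => ?_)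
        simp [mul_comm]
    _ = _ := h1.symm
    _ = 0 := by
        rw [← integral_zero ℝ ℂ]
        refine integral_congr_ae ?_
        filter_upwards [h0] with x hx
        simp [hx]

/-! ### A function in the effective domain -/

theorem integrable_exp_neg_mul_abs {c : ℝ} (hc : 0 < c) :
    Integrable fun x : ℝ => Real.exp (-c * |x|) := by
  rw [← integrableOn_univ, ← Set.Iic_union_Ioi (a := (0 : ℝ))]
  refine IntegrableOn.union ?_ ?_
  · refine (integrableOn_exp_mul_Iic hc 0).congr_fun (fun x hx => ?_) measurableSet_Iic
    simp [abs_of_nonpos (Set.mem_Iic.1 hx)]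
  · refine (exp_neg_integrableOn_Ioi 0 hc).congr_fun (fun x hx => ?_) measurableSet_Ioi
    simp [abs_of_pos (Set.mem_Ioi.1 hx)]

theorem integrable_ofReal_exp_neg_abs : Integrable fun x : ℝ => (Real.exp (-|x|) : ℂ) := by
  have := (integrable_exp_neg_mul_abs one_pos).ofReal (𝕜 := ℂ)
  simpa using this

theorem fourier_exp_neg_abs (k : ℝ) :
    fourier (fun x => (Real.exp (-|x|) : ℂ)) k = 2 / (1 + (k : ℂ) ^ 2) := by
  have h1 : (1 + Complex.I * k) ≠ 0 := fun h => by simpa using congrArg Complex.re h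
  have h2 : (1 - Complex.I * k) ≠ 0 := fun h => by simpa using congrArg Complex.re h
  have hint' := integrable_mul_cexp integrable_ofReal_exp_neg_abs k
  rw [fourier, ← intervalIntegral.integral_Iic_add_Ioi hint'.integrableOn hint'.integrableOn
    (b := 0)]
  have e1 : ∫ x in Set.Iic (0 : ℝ), (Real.exp (-|x|) : ℂ) * Complex.exp (-(Complex.I * k * x)) =
      1 / (1 - Complex.I * k) := by
    have := integral_exp_mul_complex_Iic (a := 1 - Complex.I * k) (by simp) 0
    simp only [Complex.ofReal_zero, mul_zero, Complex.exp_zero] at this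
    rw [← this]
    refine setIntegral_congr_fun measurableSet_Iic fun x hx => ?_
    simp only [abs_of_nonpos (Set.mem_Iic.1 hx), neg_neg, Complex.ofReal_exp, ← Complex.exp_add]
    congr 1; ring
  have e2 : ∫ x in Set.Ioi (0 : ℝ), (Real.exp (-|x|) : ℂ) * Complex.exp (-(Complex.I * k * x)) =
      1 / (1 + Complex.I * k) := by
    have := integral_exp_mul_complex_Ioi (a := -(1 + Complex.I * k)) (by simp) 0
    simp only [Complex.ofReal_zero, mul_zero, Complex.exp_zero, neg_div_neg_eq] at this
    rw [← this]
    refine setIntegral_congr_fun measurableSet_Ioi fun x hx => ?_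
    simp only [abs_of_pos (Set.mem_Ioi.1 hx), Complex.ofReal_exp, ← Complex.exp_add,
      Complex.ofReal_neg]
    congr 1; ring
  rw [e1, e2]
  have h3 : (1 + (k : ℂ) ^ 2) = (1 + Complex.I * k) * (1 - Complex.I * k) := by
    ring_nf; simp
  rw [h3]
  field_simp
  ring

/-- `m̂(k) = e^{-|k|}` defines an element of the effective domain. -/
theorem primalDomain_nonempty {γ : ℝ} (hγ : 2 < γ) : (primalDomain γ).Nonempty := by
  set f : ℝ → ℂ := fun x => (Real.exp (-|x|) : ℂ) with hf
  have hfc : Continuous f := by fun_prop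
  have hfi : Integrable f := integrable_ofReal_exp_neg_abs
  have hff : Integrable (fourier f) := by
    have := (integrable_inv_one_add_sq.const_mul 2).ofReal (𝕜 := ℂ)
    refine this.congr (Eventually.of_forall fun k => ?_)
    rw [fourier_exp_neg_abs]
    push_cast
    rw [div_eq_mul_inv]
    rfl
  set m := fun x => (2 * Real.pi : ℂ)⁻¹ * fourier f (-x) with hm
  have hmi : Integrable m := (hff.comp_neg).const_mul _
  refine ⟨hmi.toL1 m, ?_⟩
  have h1 : fourier (hmi.toL1 m) = f :=
    (fourier_congr_ae hmi.coeFn_toL1).trans (funext (fourier_fourier_neg hfc hfi hff))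
  unfold primalDomain
  simp only [Set.mem_ofPred_eq, h1, memL2_iff]
  have hcont : Continuous fun k => (Real.exp (-γ * k / 2) : ℂ) * (f k - expFun k) := by
    unfold expFun
    fun_prop
  rw [memLp_two_iff_integrable_sq_norm hcont.aestronglyMeasurable]
  -- The difference vanishes for k ≤ 0 and is at most e^k for k > 0, where the weighted square is
  -- therefore at most e^{−(γ−2)k}. Here γ > 2 enters.
  refine (integrable_exp_neg_mul_abs (c := γ - 2) (by linarith)).mono'
    (hcont.norm.pow 2).aestronglyMeasurable (Eventually.of_forall fun k => ?_)
  simp only [hf, expFun, norm_pow, norm_mul, Complex.norm_real, Real.norm_eq_abs,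
    Real.abs_exp, ← Complex.ofReal_sub, abs_abs]
  rcases le_or_gt k 0 with hk | hk
  · simp [abs_of_nonpos hk, Real.exp_nonneg]
  · have h2 : |Real.exp (-|k|) - Real.exp k| ≤ Real.exp k := by
      rw [abs_of_pos hk, abs_le]
      have : Real.exp (-k) ≤ Real.exp k := Real.exp_le_exp.2 (by linarith)
      constructor <;> linarith [Real.exp_pos k, Real.exp_pos (-k)]
    calc (Real.exp (-γ * k / 2) * |Real.exp (-|k|) - Real.exp k|) ^ 2
        ≤ (Real.exp (-γ * k / 2) * Real.exp k) ^ 2 := by gcongr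
      _ = Real.exp (-(γ - 2) * |k|) := by
        rw [← Real.exp_add, ← Real.exp_nat_mul, abs_of_pos hk]
        congr 1; push_cast; ring

/-- The zero function is not in the effective domain. -/
theorem ne_zero_of_mem_primalDomain {γ : ℝ} (hγ : 2 < γ) {m : L1} (hm : m ∈ primalDomain γ) :
    m ≠ 0 := by
  rintro rfl
  have h0 : fourier ((0 : L1) : ℝ → ℂ) = 0 := by
    rw [fourier_congr_ae (Lp.coeFn_zero ℂ 1 volume)]
    funext k
    simp [fourier]
  unfold primalDomain at hm
  simp only [Set.mem_ofPred_eq, h0, memL2_iff] at hm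
  have h1 := (memLp_two_iff_integrable_sq_norm hm.1).1 hm
  -- For k ≤ 0 the weighted square of exp is e^{(2−γ)k} ≥ 1.
  have h2 : IntegrableOn (fun _ : ℝ => (1 : ℝ)) (Set.Iic 0) := by
    refine (h1.integrableOn (s := Set.Iic 0)).mono' (by fun_prop) ?_
    refine (ae_restrict_iff' measurableSet_Iic).2 (Eventually.of_forall fun k hk => ?_)
    have hk : k ≤ 0 := hk
    simp only [Pi.zero_apply, zero_sub, norm_mul, norm_neg, expFun, Complex.norm_real,
      Real.norm_eq_abs, Real.abs_exp, ← Real.exp_add, ← Real.exp_nat_mul, abs_one]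
    rw [Real.one_le_exp_iff]
    push_cast
    nlinarith
  simp [integrableOn_const_iff] at h2

/-! ### The pairing of the exponential with a Fourier transform -/

theorem IsTestFunction.comp_mul_mul_cexp {φ : ℝ → ℂ} (h : IsTestFunction φ) {ε : ℝ} (hε : 0 < ε)
    (y : ℝ) : IsTestFunction fun k : ℝ => φ (ε * k) * Complex.exp (-(Complex.I * y * k)) := by
  refine ⟨?_, ?_⟩
  · refine (h.1.comp (contDiff_const.mul contDiff_id)).mul ?_
    exact ContDiff.cexp (contDiff_const.mul Complex.ofRealCLM.contDiff).neg
  · refine HasCompactSupport.mul_right ?_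
    exact h.2.comp_homeomorph (Homeomorph.mulLeft₀ ε hε.ne')

theorem fourier_comp_mul_mul_cexp (φ : ℝ → ℂ) {ε : ℝ} (hε : 0 < ε) (y x : ℝ) :
    fourier (fun k : ℝ => φ (ε * k) * Complex.exp (-(Complex.I * y * k))) x =
      (ε⁻¹ : ℝ) • fourier φ (ε⁻¹ * (x + y)) := by
  have h := Measure.integral_comp_mul_left
    (fun k : ℝ => φ k * Complex.exp (-(Complex.I * ((ε⁻¹ * (x + y) : ℝ) : ℂ) * k))) ε
  rw [abs_of_pos (by positivity)] at h
  rw [fourier, fourier, ← h]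
  refine integral_congr_ae (Eventually.of_forall fun k => ?_)
  have : (ε : ℂ) ≠ 0 := by exact_mod_cast hε.ne'
  simp only [mul_assoc, ← Complex.exp_add]
  congr 2
  push_cast
  field_simp
  ring

theorem IsDualAdmissible.integrable_comp_mul_mul {γ : ℝ} {g : C₀(ℝ, ℂ)} {u φ : ℝ → ℂ}
    (hu : IsDualAdmissible γ g u) (hφ : IsTestFunction φ) {ε : ℝ} (hε : 0 < ε) :
    Integrable fun k => φ (ε * k) * u k :=
  hu.1.1.integrable_smul_left_of_hasCompactSupport (hφ.continuous.comp (continuous_const_mul ε))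
    (hφ.2.comp_homeomorph (Homeomorph.mulLeft₀ ε hε.ne'))

/-- A cutoff of `u` mollifies `g`: φ(εk) e^{−iyk} is itself a test function, and its transform is a
translated copy of φ̂ concentrated at scale ε around −y. -/
theorem IsDualAdmissible.fourier_comp_mul_mul {γ : ℝ} {g : C₀(ℝ, ℂ)} {u φ : ℝ → ℂ}
    (hu : IsDualAdmissible γ g u) (hφ : IsTestFunction φ) {ε : ℝ} (hε : 0 < ε) (y : ℝ) :
    fourier (fun k => φ (ε * k) * u k) y = ∫ t, g (ε * t - y) * fourier φ t := by
  have h := hu.1.2 _ (hφ.comp_mul_mul_cexp hε y)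
  have h2 := Measure.integral_comp_mul_left
    (fun x : ℝ => g (x - y) * ((ε⁻¹ : ℝ) • fourier φ (ε⁻¹ * x))) ε
  rw [abs_of_pos (by positivity)] at h2
  have h3 := integral_add_right_eq_self (μ := volume)
    (fun x : ℝ => g (x - y) * ((ε⁻¹ : ℝ) • fourier φ (ε⁻¹ * x))) y
  calc fourier (fun k => φ (ε * k) * u k) y
      = ∫ k, u k * (φ (ε * k) * Complex.exp (-(Complex.I * y * k))) := by
        refine integral_congr_ae (Eventually.of_forall fun k => ?_)
        simp only
        ring
    _ = ∫ x, g x * ((ε⁻¹ : ℝ) • fourier φ (ε⁻¹ * (x + y))) := by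
        simp_rw [h, fourier_comp_mul_mul_cexp φ hε y]
    _ = ∫ x, g (x - y) * ((ε⁻¹ : ℝ) • fourier φ (ε⁻¹ * x)) := by
        rw [← h3]
        simp
    _ = ε • ∫ t, g (ε * t - y) * ((ε⁻¹ : ℝ) • fourier φ (ε⁻¹ * (ε * t))) := by
        rw [h2, smul_smul, mul_inv_cancel₀ hε.ne', one_smul]
    _ = ∫ t, g (ε * t - y) * fourier φ t := by
        rw [← integral_smul]
        refine integral_congr_ae (Eventually.of_forall fun t => ?_)
        have : (ε : ℂ) ≠ 0 := by exact_mod_cast hε.ne'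
        simp only [← mul_assoc, inv_mul_cancel₀ hε.ne', one_mul, Complex.real_smul]
        push_cast
        field_simp

theorem continuous_zeroAtInfty (g : C₀(ℝ, ℂ)) : Continuous g := g.continuous_toFun

theorem norm_apply_le (g : C₀(ℝ, ℂ)) (x : ℝ) : ‖g x‖ ≤ ‖g‖ :=
  (g.toBCF.norm_coe_le_norm x).trans_eq (ZeroAtInftyContinuousMap.norm_toBCF_eq_norm)

/-- Parseval's identity for u m̂, which need not be integrable. After the cutoff is moved to the
other side, the mollified values of `g` stay bounded and converge to g(−y) ∫ φ̂ = 2π φ(0) g(−y), so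
a multiple of |m| dominates. -/
theorem tendsto_integral_comp_mul_mul_fourier {γ : ℝ} {g : C₀(ℝ, ℂ)} {u φ m : ℝ → ℂ}
    (hu : IsDualAdmissible γ g u) (hφ : IsTestFunction φ) (hm : Integrable m) :
    Tendsto (fun ε : ℝ => ∫ k, φ (ε * k) * u k * fourier m k) (𝓝[>] 0)
      (𝓝 (2 * Real.pi * φ 0 * ∫ y, m y * g (-y))) := by
  have hff := hφ.integrable_fourier
  have key : ∀ y, Tendsto (fun ε : ℝ => ∫ t, g (ε * t - y) * fourier φ t) (𝓝[>] 0)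
      (𝓝 (∫ t, g (-y) * fourier φ t)) := fun y => by
    refine tendsto_integral_filter_of_dominated_convergence (fun t => ‖g‖ * ‖fourier φ t‖)
      (Eventually.of_forall fun ε => ?_) (Eventually.of_forall fun ε =>
        Eventually.of_forall fun t => ?_) (hff.norm.const_mul _)
        (Eventually.of_forall fun t => ?_)
    · exact ((continuous_zeroAtInfty g).comp (by fun_prop)).aestronglyMeasurable.mul hff.1
    · rw [norm_mul]
      gcongr
      exact norm_apply_le g _
    · refine Tendsto.mul_const _ ?_
      have : Continuous fun ε : ℝ => g (ε * t - y) := (continuous_zeroAtInfty g).comp (by fun_prop)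
      have h2 := this.tendsto 0
      simp only [zero_mul, zero_sub] at h2
      exact h2.mono_left nhdsWithin_le_nhds
  have h1 : Tendsto (fun ε : ℝ => ∫ y, m y * fourier (fun k => φ (ε * k) * u k) y) (𝓝[>] 0)
      (𝓝 (∫ y, m y * ∫ t, g (-y) * fourier φ t)) := by
    refine tendsto_integral_filter_of_dominated_convergence
      (fun y => ‖m y‖ * ∫ t, ‖g‖ * ‖fourier φ t‖) ?_ ?_ (hm.norm.mul_const _)
      (Eventually.of_forall fun y => ?_)
    · filter_upwards [self_mem_nhdsWithin] with ε hε
      exact hm.1.mul (continuous_fourier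
        (IsDualAdmissible.integrable_comp_mul_mul hu hφ hε)).aestronglyMeasurable
    · filter_upwards [self_mem_nhdsWithin] with ε hε
      refine Eventually.of_forall fun y => ?_
      rw [norm_mul, IsDualAdmissible.fourier_comp_mul_mul hu hφ hε]
      gcongr
      refine norm_integral_le_of_norm_le (hff.norm.const_mul _) (Eventually.of_forall fun t => ?_)
      rw [norm_mul]
      gcongr
      exact norm_apply_le g _
    · refine Tendsto.const_mul _ ((key y).congr' ?_)
      filter_upwards [self_mem_nhdsWithin] with ε hε
      exact (IsDualAdmissible.fourier_comp_mul_mul hu hφ hε y).symm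
  have h2 : ∫ y, m y * ∫ t, g (-y) * fourier φ t = 2 * Real.pi * φ 0 * ∫ y, m y * g (-y) := by
    simp_rw [integral_const_mul, integral_fourier hφ.continuous hφ.integrable hff, ← mul_assoc,
      integral_mul_const]
    ring
  rw [← h2]
  refine h1.congr' ?_
  filter_upwards [self_mem_nhdsWithin] with ε hε
  rw [← integral_fourier_mul hm (IsDualAdmissible.integrable_comp_mul_mul hu hφ hε)]
  refine integral_congr_ae (Eventually.of_forall fun k => ?_)
  simp only
  ring

/-- The value of `⟨exp, ĝ⟩`, computed with the help of an element `m` of the effective domain. -/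
noncomputable def expPairing (m : ℝ → ℂ) (g : C₀(ℝ, ℂ)) (u : ℝ → ℂ) : ℂ :=
  2 * Real.pi * (∫ y, m y * g (-y)) - ∫ k, u k * (fourier m k - expFun k)

theorem IsTestFunction.exists_bound {φ : ℝ → ℂ} (hφ : IsTestFunction φ) :
    ∃ C, ∀ x, ‖φ x‖ ≤ C :=
  hφ.continuous.bounded_above_of_compact_support hφ.2

/-- Split exp = m̂ − (m̂ − exp). The first part is the regularized Parseval identity; the second is
integrable against `u` by Cauchy–Schwarz, so its cutoff can be removed by dominated convergence. As
the limit does not involve `m`, the value of `expPairing` is the same for all `m` in the effective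
domain, which weak duality exploits. -/
theorem hasExpPairing_expPairing {γ : ℝ} {g : C₀(ℝ, ℂ)} {u : ℝ → ℂ}
    (hu : IsDualAdmissible γ g u) {m : L1} (hm : m ∈ primalDomain γ) :
    HasExpPairing u (expPairing m g u) := by
  intro φ hφ h0
  have hmi : Integrable m := L1.integrable_coeFn m
  obtain ⟨C, hC⟩ := hφ.exists_bound
  have h1 := tendsto_integral_comp_mul_mul_fourier hu hφ hmi
  have hw : Integrable fun k => u k * (fourier m k - expFun k) := hu.2.integrable_mul hm
  have hbd : ∀ ε : ℝ, Integrable fun k => φ (ε * k) * (u k * (fourier m k - expFun k)) := fun ε =>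
    hw.bdd_mul (c := C) (hφ.continuous.comp (continuous_const_mul ε)).aestronglyMeasurable
      (Eventually.of_forall fun k => hC _)
  have h2 : Tendsto (fun ε : ℝ => ∫ k, φ (ε * k) * (u k * (fourier m k - expFun k))) (𝓝[>] 0)
      (𝓝 (∫ k, u k * (fourier m k - expFun k))) := by
    refine tendsto_integral_filter_of_dominated_convergence
      (fun k => C * ‖u k * (fourier m k - expFun k)‖) (Eventually.of_forall fun ε => (hbd ε).1)
      (Eventually.of_forall fun ε => Eventually.of_forall fun k => ?_) (hw.norm.const_mul _)
      (Eventually.of_forall fun k => ?_)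
    · rw [norm_mul]
      gcongr
      exact hC _
    · have : Continuous fun ε : ℝ => φ (ε * k) * (u k * (fourier m k - expFun k)) :=
        (hφ.continuous.comp (by fun_prop)).mul continuous_const
      have h2 := this.tendsto 0
      simp only [zero_mul, h0, one_mul] at h2
      exact h2.mono_left nhdsWithin_le_nhds
  have h3 := h1.sub h2
  rw [h0, mul_one] at h3
  refine h3.congr' ?_
  filter_upwards [self_mem_nhdsWithin] with ε hε
  rw [← integral_sub _ (hbd ε)]
  · refine integral_congr_ae (Eventually.of_forall fun k => ?_)
    simp only
    ring
  · exact (IsDualAdmissible.integrable_comp_mul_mul hu hφ hε).mul_bdd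
      (c := ∫ x, ‖(m : ℝ → ℂ) x‖) (continuous_fourier hmi).aestronglyMeasurable
      (Eventually.of_forall fun k => norm_fourier_le _ k)

theorem HasExpPairing.unique {u : ℝ → ℂ} {z z' : ℂ} (h : HasExpPairing u z)
    (h' : HasExpPairing u z') : z = z' := by
  obtain ⟨φ, hφ, h0⟩ := exists_isTestFunction_eq_one
  exact tendsto_nhds_unique (h φ hφ h0) (h' φ hφ h0)

theorem norm_L1_eq (m : L1) : ‖m‖ = ∫ x, ‖(m : ℝ → ℂ) x‖ := L1.norm_eq_integral_norm m

theorem norm_expPairing_le {γ : ℝ} {g : C₀(ℝ, ℂ)} {u : ℝ → ℂ}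
    (hu : MemL2 (-γ) u) {m : L1} (hm : m ∈ primalDomain γ) :
    ‖expPairing m g u‖ ≤ 2 * Real.pi * ‖m‖ * ‖g‖ +
      normL2 γ (fun k => fourier m k - expFun k) * normL2 (-γ) u := by
  refine (norm_sub_le _ _).trans (add_le_add ?_ ?_)
  · rw [norm_mul, norm_mul, Complex.norm_real, Complex.norm_ofNat, Real.norm_eq_abs,
      abs_of_pos Real.pi_pos, mul_assoc (2 * Real.pi), norm_L1_eq, ← integral_mul_const]
    gcongr
    refine norm_integral_le_of_norm_le ((L1.integrable_coeFn m).norm.mul_const _)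
      (Eventually.of_forall fun y => ?_)
    rw [norm_mul]
    gcongr
    exact norm_apply_le g _
  · rw [mul_comm]
    exact hu.norm_integral_mul_le hm

/-! ### Test functions as Fourier transforms -/

/-- The inverse Fourier transform of a test function. -/
noncomputable def invFourier {φ : ℝ → ℂ} (hφ : IsTestFunction φ) : C₀(ℝ, ℂ) where
  toFun x := (2 * Real.pi : ℂ)⁻¹ * fourier φ (-x)
  continuous_toFun := by
    have := continuous_fourier hφ.integrable
    fun_prop
  zero_at_infty' := by
    rw [← mul_zero (2 * Real.pi : ℂ)⁻¹]
    refine Tendsto.const_mul _ ?_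
    have h1 : Tendsto (FourierTransform.fourier φ) (cocompact ℝ) (𝓝 0) :=
      Real.zero_at_infty_fourier φ
    have h2 := h1.comp ((Homeomorph.mulLeft₀ (-(2 * Real.pi)⁻¹)
      (by simp [Real.pi_ne_zero])).isClosedEmbedding.tendsto_cocompact)
    refine h2.congr fun x => ?_
    simp only [Function.comp, Homeomorph.coe_mulLeft₀, fourier_eq]
    ring_nf

theorem invFourier_apply {φ : ℝ → ℂ} (hφ : IsTestFunction φ) (x : ℝ) :
    invFourier hφ x = (2 * Real.pi : ℂ)⁻¹ * fourier φ (-x) := rfl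

theorem IsTestFunction.memL2 {φ : ℝ → ℂ} (hφ : IsTestFunction φ) (γ : ℝ) : MemL2 γ φ := by
  rw [memL2_iff]
  refine Continuous.memLp_of_hasCompactSupport ?_ hφ.2.mul_left
  have := hφ.continuous
  fun_prop

theorem isDualAdmissible_invFourier {φ : ℝ → ℂ} (hφ : IsTestFunction φ) (γ : ℝ) :
    IsDualAdmissible γ (invFourier hφ) φ := by
  refine ⟨⟨hφ.integrable.locallyIntegrable, fun ψ hψ => ?_⟩, hφ.memL2 _⟩
  have hi : Integrable (invFourier hφ) := (hφ.integrable_fourier.comp_neg).const_mul _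
  rw [← integral_fourier_mul hi hψ.integrable]
  refine integral_congr_ae (Eventually.of_forall fun k => ?_)
  simp only
  congr 1
  exact (fourier_fourier_neg hφ.continuous hφ.integrable hφ.integrable_fourier k).symm

/-- On test functions the pairing is the plain integral; this later identifies the Hahn–Banach
extension with exp in the sense of distributions. -/
theorem expPairing_invFourier {φ : ℝ → ℂ} (hφ : IsTestFunction φ) {γ : ℝ} {m : L1}
    (hm : m ∈ primalDomain γ) :
    expPairing m (invFourier hφ) φ = ∫ k, φ k * expFun k := by
  have hmi : Integrable m := L1.integrable_coeFn m
  have hw : Integrable fun k => φ k * (fourier m k - expFun k) := (hφ.memL2 (-γ)).integrable_mul hm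
  have h1 : 2 * Real.pi * (∫ y, (m : ℝ → ℂ) y * invFourier hφ (-y)) = ∫ k, φ k * fourier m k := by
    have := integral_fourier_mul hmi hφ.integrable
    simp_rw [mul_comm (φ _)]
    rw [this, ← integral_const_mul]
    refine integral_congr_ae (Eventually.of_forall fun y => ?_)
    have : (Real.pi : ℂ) ≠ 0 := by exact_mod_cast Real.pi_ne_zero
    simp only [invFourier_apply, neg_neg]
    field_simp
  have hf : Integrable fun k => φ k * fourier m k := hφ.integrable.mul_bdd
    (c := ∫ x, ‖(m : ℝ → ℂ) x‖) (continuous_fourier hmi).aestronglyMeasurable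
    (Eventually.of_forall fun k => norm_fourier_le _ k)
  rw [expPairing, h1, ← integral_sub hf hw]
  refine integral_congr_ae (Eventually.of_forall fun k => ?_)
  simp only
  ring

theorem invFourier_ne_zero {φ : ℝ → ℂ} (hφ : IsTestFunction φ) (h : φ 0 ≠ 0) :
    invFourier hφ ≠ 0 := by
  intro h0
  apply h
  rw [← fourier_fourier_neg hφ.continuous hφ.integrable hφ.integrable_fourier 0]
  have : (fun x => (2 * Real.pi : ℂ)⁻¹ * fourier φ (-x)) = 0 := by
    funext x
    rw [← invFourier_apply hφ, h0]
    rfl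
  rw [this]
  simp [fourier]

/-! ### The scaling transformation -/

theorem ofReal_cpow_eq {α : ℝ} (hα : 0 < α) (x : ℝ) :
    (α : ℂ) ^ (-(Complex.I * (x : ℂ)) - 1) =
      (α : ℂ)⁻¹ * Complex.exp (-(Complex.I * (Real.log α : ℂ) * x)) := by
  have h0 : (α : ℂ) ≠ 0 := by exact_mod_cast hα.ne'
  rw [Complex.cpow_sub _ _ h0, Complex.cpow_one, Complex.cpow_def_of_ne_zero h0,
    ← Complex.ofReal_log hα.le, div_eq_inv_mul]
  congr 2
  ring

theorem norm_ofReal_cpow {α : ℝ} (hα : 0 < α) (x : ℝ) :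
    ‖(α : ℂ) ^ (-(Complex.I * (x : ℂ)) - 1)‖ = α⁻¹ := by
  rw [ofReal_cpow_eq hα, norm_mul, norm_cexp_neg_I_mul, norm_inv, Complex.norm_real,
    Real.norm_eq_abs, abs_of_pos hα, mul_one]

theorem integrable_mul_cpow {m : ℝ → ℂ} (hm : Integrable m) {α : ℝ} (hα : 0 < α) :
    Integrable fun x : ℝ => m x * (α : ℂ) ^ (-(Complex.I * (x : ℂ)) - 1) := by
  refine hm.mul_bdd (c := α⁻¹) ?_ (Eventually.of_forall fun x => (norm_ofReal_cpow hα x).le)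
  simp_rw [ofReal_cpow_eq hα]
  fun_prop

/-- The transformation `m(x) ↦ m(x) α^{-ix-1}` of `L¹(ℝ)`. -/
noncomputable def scale {α : ℝ} (hα : 0 < α) (m : L1) : L1 :=
  (integrable_mul_cpow (L1.integrable_coeFn m) hα).toL1 _

theorem coeFn_scale {α : ℝ} (hα : 0 < α) (m : L1) :
    scale hα m =ᵐ[volume] fun x : ℝ => m x * (α : ℂ) ^ (-(Complex.I * (x : ℂ)) - 1) :=
  Integrable.coeFn_toL1 _

theorem norm_scale {α : ℝ} (hα : 0 < α) (m : L1) : ‖scale hα m‖ = α⁻¹ * ‖m‖ := by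
  rw [norm_L1_eq, norm_L1_eq, ← integral_const_mul]
  refine integral_congr_ae ?_
  filter_upwards [coeFn_scale hα m] with x hx
  rw [hx, norm_mul, norm_ofReal_cpow hα, mul_comm]

theorem fourier_scale {α : ℝ} (hα : 0 < α) (m : L1) (k : ℝ) :
    fourier (scale hα m) k = (α : ℂ)⁻¹ * fourier m (k + Real.log α) := by
  rw [fourier_congr_ae (coeFn_scale hα m), fourier, fourier, ← integral_const_mul]
  refine integral_congr_ae (Eventually.of_forall fun x => ?_)
  simp only [ofReal_cpow_eq hα]
  rw [show -(Complex.I * ((k + Real.log α : ℝ) : ℂ) * x) =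
    -(Complex.I * (Real.log α : ℂ) * x) + -(Complex.I * k * x) by push_cast; ring, Complex.exp_add]
  ring

/-- The map F ↦ α⁻¹ F(· + log α) fixes exp, so the difference transforms in the same way as m̂. -/
theorem fourier_scale_sub_expFun {α : ℝ} (hα : 0 < α) (m : L1) (k : ℝ) :
    fourier (scale hα m) k - expFun k =
      (α : ℂ)⁻¹ * (fourier m (k + Real.log α) - expFun (k + Real.log α)) := by
  have h0 : (α : ℂ) ≠ 0 := by exact_mod_cast hα.ne'
  rw [fourier_scale hα, mul_sub]
  congr 1
  simp only [expFun, Real.exp_add, Real.exp_log hα]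
  push_cast
  field_simp

theorem eLpNorm_scaled {α : ℝ} (hα : 0 < α) (γ : ℝ) {F : ℝ → ℂ} (hF : AEStronglyMeasurable F) :
    eLpNorm (fun k => (α : ℂ)⁻¹ * F (k + Real.log α)) 2 (expWeight γ) =
      ENNReal.ofReal (α ^ (γ / 2 - 1)) * eLpNorm F 2 (expWeight γ) := by
  have h0 : (α : ℂ) ≠ 0 := by exact_mod_cast hα.ne'
  rw [eLpNorm_expWeight, eLpNorm_expWeight]
  set H : ℝ → ℂ := fun k => (Real.exp (-γ * k / 2) : ℂ) * F k with hH
  have hHm : AEStronglyMeasurable H := (by fun_prop : Continuous fun k : ℝ =>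
    (Real.exp (-γ * k / 2) : ℂ)).aestronglyMeasurable.mul hF
  have hα' : α ^ (γ / 2 - 1) = α⁻¹ * Real.exp (γ * Real.log α / 2) := by
    rw [Real.rpow_sub_one hα.ne', Real.rpow_def_of_pos hα, div_eq_inv_mul]
    congr 2
    ring
  have h1 : (fun k => (Real.exp (-γ * k / 2) : ℂ) * ((α : ℂ)⁻¹ * F (k + Real.log α))) =
      ((α ^ (γ / 2 - 1) : ℝ) : ℂ) • (H ∘ fun k => k + Real.log α) := by
    funext k
    simp only [hH, Pi.smul_apply, Function.comp, smul_eq_mul, hα']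
    have : Real.exp (-γ * k / 2) =
        Real.exp (γ * Real.log α / 2) * Real.exp (-γ * (k + Real.log α) / 2) := by
      rw [← Real.exp_add]
      congr 1
      ring
    rw [this]
    push_cast
    ring
  rw [h1, eLpNorm_const_smul,
    eLpNorm_comp_measurePreserving hHm (measurePreserving_add_right volume (Real.log α))]
  congr 1
  rw [← ofReal_norm, Complex.norm_real, Real.norm_eq_abs,
    abs_of_pos (Real.rpow_pos_of_pos hα _)]

theorem scale_mem_primalDomain {α : ℝ} (hα : 0 < α) {γ : ℝ} {m : L1} (hm : m ∈ primalDomain γ) :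
    scale hα m ∈ primalDomain γ := by
  have hm' : MemL2 γ fun k => fourier m k - expFun k := hm
  have hmeas := hm'.aestronglyMeasurable
  refine ⟨?_, ?_⟩ <;> simp_rw [fourier_scale_sub_expFun hα]
  · refine aestronglyMeasurable_expWeight_iff.2 (AEStronglyMeasurable.const_mul ?_ _)
    exact hmeas.comp_measurePreserving (measurePreserving_add_right volume (Real.log α))
  · rw [eLpNorm_scaled hα γ hmeas]
    exact ENNReal.mul_lt_top ENNReal.ofReal_lt_top hm'.2

theorem normL2_scale {α : ℝ} (hα : 0 < α) {γ : ℝ} {m : L1} (hm : m ∈ primalDomain γ) :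
    normL2 γ (fun k => fourier (scale hα m) k - expFun k) =
      α ^ (γ / 2 - 1) * normL2 γ fun k => fourier m k - expFun k := by
  have hm' : MemL2 γ fun k => fourier m k - expFun k := hm
  simp_rw [fourier_scale_sub_expFun hα]
  rw [normL2, eLpNorm_scaled hα γ hm'.aestronglyMeasurable, ENNReal.toReal_mul,
    ENNReal.toReal_ofReal (Real.rpow_nonneg hα.le _), normL2]

/-- The powers γ − 2 and 2 are exactly those for which the factors α⁻¹ of the L¹ norm and α^{γ/2−1}
of the weighted norm cancel. -/
theorem primalFunctional_scale {α : ℝ} (hα : 0 < α) {γ : ℝ} {m : L1}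
    (hm : m ∈ primalDomain γ) : primalFunctional γ (scale hα m) = primalFunctional γ m := by
  rw [primalFunctional, primalFunctional, normL2_scale hα hm, norm_scale,
    Real.mul_rpow (by positivity) (norm_nonneg _), mul_pow]
  have : α⁻¹ ^ (γ - 2) * (α ^ (γ / 2 - 1)) ^ 2 = 1 := by
    rw [← Real.rpow_mul_natCast hα.le, Real.inv_rpow hα.le, ← Real.rpow_neg hα.le,
      ← Real.rpow_add hα]
    rw [show -(γ - 2) + (γ / 2 - 1) * ((2 : ℕ) : ℝ) = 0 by push_cast; ring, Real.rpow_zero]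
  linear_combination (‖m‖ ^ (γ - 2) * normL2 γ (fun k => fourier m k - expFun k) ^ 2) * this

/-! ### Uniqueness of minimizers -/

theorem primalFunctional_nonneg (γ : ℝ) (m : L1) : 0 ≤ primalFunctional γ m := by
  unfold primalFunctional
  positivity

theorem bddBelow_primalFunctional (γ : ℝ) : BddBelow (primalFunctional γ '' primalDomain γ) :=
  ⟨0, by rintro _ ⟨m, -, rfl⟩; exact primalFunctional_nonneg γ m⟩

theorem primalInf_le {γ : ℝ} {m : L1} (hm : m ∈ primalDomain γ) :
    primalInf γ ≤ primalFunctional γ m :=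
  csInf_le (bddBelow_primalFunctional γ) ⟨m, hm, rfl⟩

theorem fourier_add_L1 (m m' : L1) (k : ℝ) :
    fourier (m + m' : L1) k = fourier m k + fourier m' k := by
  rw [fourier_congr_ae (Lp.coeFn_add m m'), fourier, fourier, fourier,
    ← integral_add (integrable_mul_cexp (L1.integrable_coeFn m) k)
      (integrable_mul_cexp (L1.integrable_coeFn m') k)]
  refine integral_congr_ae (Eventually.of_forall fun x => ?_)
  simp only [Pi.add_apply]
  ring

theorem fourier_smul_L1 (c : ℂ) (m : L1) (k : ℝ) :
    fourier (c • m : L1) k = c * fourier m k := by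
  rw [fourier_congr_ae (Lp.coeFn_smul c m), fourier, fourier, ← integral_const_mul]
  refine integral_congr_ae (Eventually.of_forall fun x => ?_)
  simp only [Pi.smul_apply, smul_eq_mul]
  ring

theorem eq_of_fourier_ae_eq {m m' : L1} (h : fourier m =ᵐ[volume] fourier m') : m = m' := by
  have h1 : fourier (m + (-1 : ℂ) • m' : L1) =ᵐ[volume] 0 := by
    filter_upwards [h] with k hk
    rw [fourier_add_L1, fourier_smul_L1, hk]
    simp
  have h2 := ae_eq_zero_of_fourier_ae_eq_zero (L1.integrable_coeFn _) h1
  have h3 : m + (-1 : ℂ) • m' = 0 := Lp.ext (h2.trans (Lp.coeFn_zero ℂ 1 volume).symm)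
  simpa [add_neg_eq_zero] using h3

theorem IsPrimalMinimizer.scale {γ : ℝ} {m : L1} (hm : IsPrimalMinimizer γ m) {α : ℝ}
    (hα : 0 < α) : IsPrimalMinimizer γ (scale hα m) :=
  ⟨scale_mem_primalDomain hα hm.1, (primalFunctional_scale hα hm.1).trans hm.2⟩

/-- By strict convexity there is only one minimizer of a given norm. -/
theorem IsPrimalMinimizer.eq_of_norm_eq {γ : ℝ} (hγ : 2 < γ) {m m' : L1}
    (hm : IsPrimalMinimizer γ m) (hm' : IsPrimalMinimizer γ m') (hn : ‖m‖ = ‖m'‖) : m = m' := by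
  have hd : MemLp (fun k => fourier m k - expFun k) 2 (expWeight γ) := hm.1
  have hd' : MemLp (fun k => fourier m' k - expFun k) 2 (expWeight γ) := hm'.1
  set H := hd.toLp with hH
  set H' := hd'.toLp with hH'
  have hpos : 0 < ‖m‖ ^ (γ - 2) :=
    Real.rpow_pos_of_pos (norm_pos_iff.2 (ne_zero_of_mem_primalDomain hγ hm.1)) _
  have hnH : normL2 γ (fun k => fourier m k - expFun k) = ‖H‖ := (Lp.norm_toLp _ hd).symm
  have hnH' : normL2 γ (fun k => fourier m' k - expFun k) = ‖H'‖ := (Lp.norm_toLp _ hd').symm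
  have hval : ‖m‖ ^ (γ - 2) * ‖H‖ ^ 2 = primalInf γ := by rw [← hm.2, primalFunctional, hnH]
  have hval' : ‖m‖ ^ (γ - 2) * ‖H'‖ ^ 2 = primalInf γ := by
    rw [← hm'.2, primalFunctional, hnH', hn]
  have heq : ‖H‖ ^ 2 = ‖H'‖ ^ 2 := mul_left_cancel₀ hpos.ne' (hval.trans hval'.symm)
  -- The midpoint has at most the common L¹ norm, so minimality gives ‖H‖ ≤ ‖(H + H')/2‖. As ‖H‖ =
  -- ‖H'‖, the parallelogram law then forces H = H'.
  set p : L1 := (2⁻¹ : ℂ) • (m + m') with hp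
  have hpf : (fun k => fourier p k - expFun k) = (2⁻¹ : ℂ) •
      ((fun k => fourier m k - expFun k) + fun k => fourier m' k - expFun k) := by
    funext k
    simp only [hp, fourier_smul_L1, fourier_add_L1, Pi.smul_apply, Pi.add_apply, smul_eq_mul]
    ring
  have hpd : MemLp (fun k => fourier p k - expFun k) 2 (expWeight γ) := by
    rw [hpf]
    exact (hd.add hd').const_smul _
  have hpn : normL2 γ (fun k => fourier p k - expFun k) = ‖(2⁻¹ : ℂ) • (H + H')‖ := by
    have : (2⁻¹ : ℂ) • (H + H') = hpd.toLp := by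
      rw [hH, hH', ← MemLp.toLp_add, ← MemLp.toLp_const_smul]
      exact MemLp.toLp_congr _ _ (by rw [hpf])
    rw [this, Lp.norm_toLp]
    rfl
  have hple : ‖p‖ ≤ ‖m‖ := by
    rw [hp, norm_smul]
    have := norm_add_le m m'
    rw [← hn] at this
    norm_num
    linarith
  have h1 := primalInf_le (γ := γ) (m := p) hpd
  rw [primalFunctional, hpn] at h1
  have h2 : ‖p‖ ^ (γ - 2) ≤ ‖m‖ ^ (γ - 2) :=
    Real.rpow_le_rpow (norm_nonneg _) hple (by linarith)
  have h3 : ‖m‖ ^ (γ - 2) * ‖H‖ ^ 2 ≤ ‖m‖ ^ (γ - 2) * (‖(2⁻¹ : ℂ)‖ * ‖H + H'‖) ^ 2 := by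
    rw [hval]
    rw [← norm_smul]
    exact h1.trans (by gcongr)
  have h4 := le_of_mul_le_mul_left h3 hpos
  have h5 := parallelogram_law_with_norm ℂ H H'
  have h6 : ‖(2⁻¹ : ℂ)‖ = 2⁻¹ := by norm_num
  rw [h6] at h4
  have h7 : ‖H - H'‖ = 0 := by
    have : ‖H - H'‖ * ‖H - H'‖ ≤ 0 := by nlinarith
    nlinarith [norm_nonneg (H - H')]
  have h8 : H = H' := sub_eq_zero.1 (norm_eq_zero.1 h7)
  have h9 := (MemLp.toLp_eq_toLp_iff hd hd').1 h8
  refine eq_of_fourier_ae_eq ?_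
  filter_upwards [(absolutelyContinuous_expWeight γ).ae_eq h9] with k hk
  exact sub_left_injective hk

theorem isPrimalMinimizer_iff {γ : ℝ} (hγ : 2 < γ) {m : L1} (hm : IsPrimalMinimizer γ m)
    (m' : L1) : IsPrimalMinimizer γ m' ↔ ∃ α : ℝ, 0 < α ∧
      m' =ᵐ[volume] fun x : ℝ => m x * (α : ℂ) ^ (-(Complex.I * (x : ℂ)) - 1) := by
  constructor
  · intro hm'
    have h0 := norm_pos_iff.2 (ne_zero_of_mem_primalDomain hγ hm.1)
    have h0' := norm_pos_iff.2 (ne_zero_of_mem_primalDomain hγ hm'.1)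
    -- With this ratio the rescaled `m` has the same norm as `m'`.
    have hα : 0 < ‖m‖ / ‖m'‖ := div_pos h0 h0'
    refine ⟨_, hα, ?_⟩
    have h := hm'.eq_of_norm_eq hγ (hm.scale hα) (by rw [norm_scale]; field_simp)
    have hs := coeFn_scale hα m
    rwa [← h] at hs
  · rintro ⟨α, hα, h⟩
    rw [Lp.ext (h.trans (coeFn_scale hα m).symm)]
    exact hm.scale hα

/-! ### Weak duality -/

/-- The right side is the γ-th power of the minimum over α. If P or Q vanishes there is no
minimizing α, and α → 0 or α → ∞ gives t = 0. -/
theorem rpow_le_of_forall_scaling {γ : ℝ} (hγ : 2 < γ) {P Q t : ℝ} (hP : 0 ≤ P) (hQ : 0 ≤ Q)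
    (ht : 0 ≤ t) (h : ∀ α : ℝ, 0 < α → t ≤ P * α⁻¹ + Q * α ^ (γ / 2 - 1)) :
    t ^ γ ≤ γ ^ γ / (4 * (γ - 2) ^ (γ - 2)) * (P ^ (γ - 2) * Q ^ 2) := by
  have hnn : 0 ≤ γ ^ γ / (4 * (γ - 2) ^ (γ - 2)) * (P ^ (γ - 2) * Q ^ 2) := by
    have : 0 < γ - 2 := by linarith
    positivity
  have hzero : t ≤ 0 → t ^ γ ≤ γ ^ γ / (4 * (γ - 2) ^ (γ - 2)) * (P ^ (γ - 2) * Q ^ 2) := by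
    intro h'
    rwa [le_antisymm h' ht, Real.zero_rpow (by linarith)]
  rcases hP.eq_or_lt with rfl | hP
  · refine hzero ?_
    have hc : Tendsto (fun α : ℝ => Q * α ^ (γ / 2 - 1)) (𝓝[>] 0) (𝓝 (Q * 0 ^ (γ / 2 - 1))) :=
      ((Real.continuousAt_rpow_const 0 _ (Or.inr (by linarith))).tendsto.mono_left
        nhdsWithin_le_nhds).const_mul Q
    rw [Real.zero_rpow (by linarith), mul_zero] at hc
    refine ge_of_tendsto hc ?_
    filter_upwards [self_mem_nhdsWithin] with α hα
    simpa using h α hα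
  rcases hQ.eq_or_lt with rfl | hQ
  · refine hzero ?_
    have hc : Tendsto (fun α : ℝ => P * α⁻¹) atTop (𝓝 (P * 0)) :=
      tendsto_inv_atTop_zero.const_mul P
    rw [mul_zero] at hc
    refine ge_of_tendsto hc ?_
    filter_upwards [eventually_gt_atTop 0] with α hα
    simpa using h α hα
  have hg : 0 < γ - 2 := by linarith
  have hγ0 : 0 < γ := by linarith
  -- Critical point: the derivative of P α⁻¹ + Q α^{γ/2−1} vanishes when α^{γ/2} = 2P / ((γ − 2) Q).
  set β := 2 * P / ((γ - 2) * Q) with hβ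
  have hβ0 : 0 < β := by positivity
  set α := β ^ (2 / γ) with hα
  have hα0 : 0 < α := by positivity
  have e1 : α ^ (γ / 2 - 1) = β * α⁻¹ := by
    rw [Real.rpow_sub_one hα0.ne', hα, ← Real.rpow_mul hβ0.le, div_eq_mul_inv]
    congr 1
    rw [show 2 / γ * (γ / 2) = 1 by field_simp, Real.rpow_one]
  have e2 : α ^ γ = β ^ 2 := by
    rw [hα, ← Real.rpow_mul hβ0.le, show 2 / γ * γ = (2 : ℕ) by field_simp; norm_num,
      Real.rpow_natCast]
  have h1 : t ≤ α⁻¹ * (P * (γ / (γ - 2))) := by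
    refine (h α hα0).trans_eq ?_
    rw [e1, hβ]
    field_simp
    ring
  refine (Real.rpow_le_rpow ht h1 hγ0.le).trans_eq ?_
  rw [Real.mul_rpow (by positivity) (by positivity), Real.mul_rpow hP.le (by positivity),
    Real.inv_rpow hα0.le, e2, Real.div_rpow hγ0.le hg.le, hβ]
  have e3 : P ^ γ = P ^ (γ - 2) * P ^ 2 := by
    rw [← Real.rpow_natCast P 2, ← Real.rpow_add hP]; congr 1; push_cast; ring
  have e4 : (γ - 2) ^ γ = (γ - 2) ^ (γ - 2) * (γ - 2) ^ 2 := by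
    rw [← Real.rpow_natCast (γ - 2) 2, ← Real.rpow_add hg]; congr 1; push_cast; ring
  rw [e3, e4]
  field_simp
  ring

/-- Weak duality. The estimate of `z` holds with every rescaling of `m` in place of `m`, and the
best α replaces the sum by a scale-invariant product. -/
theorem norm_rpow_expPairing_le {γ : ℝ} (hγ : 2 < γ) {g : C₀(ℝ, ℂ)} {u : ℝ → ℂ}
    (hu : IsDualAdmissible γ g u) {z : ℂ} (hz : HasExpPairing u z) {m : L1}
    (hm : m ∈ primalDomain γ) :
    ‖z‖ ^ γ ≤ γ ^ γ / (4 * (γ - 2) ^ (γ - 2)) * (2 * Real.pi) ^ (γ - 2) * primalFunctional γ m *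
      (‖g‖ ^ (γ - 2) * normL2 (-γ) u ^ 2) := by
  have h := rpow_le_of_forall_scaling hγ (P := 2 * Real.pi * ‖m‖ * ‖g‖)
    (Q := normL2 γ (fun k => fourier m k - expFun k) * normL2 (-γ) u) (t := ‖z‖)
    (by positivity) (mul_nonneg (normL2_nonneg _ _) (normL2_nonneg _ _)) (norm_nonneg _)
    fun α hα => by
      have hs := scale_mem_primalDomain hα hm
      rw [hz.unique (hasExpPairing_expPairing hu hs)]
      refine (norm_expPairing_le hu.2 hs).trans_eq ?_
      rw [norm_scale, normL2_scale hα hm]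
      ring
  refine h.trans_eq ?_
  rw [Real.mul_rpow (by positivity) (norm_nonneg _), Real.mul_rpow (by positivity) (norm_nonneg _),
    primalFunctional]
  ring

/-! ### Riesz representation of functionals on `C₀(ℝ, ℂ)` -/

section Riesz

open scoped NNReal CompactlySupported

theorem norm_zeroAtInfty_le {g : C₀(ℝ, ℂ)} {C : ℝ} (hC : 0 ≤ C) (h : ∀ x, ‖g x‖ ≤ C) :
    ‖g‖ ≤ C := by
  rw [← ZeroAtInftyContinuousMap.norm_toBCF_eq_norm, BoundedContinuousFunction.norm_le hC]
  exact h

/-- A continuous function dominated by an element of `C₀(ℝ)` belongs to `C₀(ℝ)`. -/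
def zeroAtInftyOfNormLe (h : ℝ → ℂ) (hc : Continuous h) (g : C₀(ℝ, ℂ))
    (hg : ∀ x, ‖h x‖ ≤ ‖g x‖) : C₀(ℝ, ℂ) where
  toFun := h
  continuous_toFun := hc
  zero_at_infty' := squeeze_zero_norm hg (by simpa using g.zero_at_infty'.norm)

variable (ℓ : C₀(ℝ, ℂ) →L[ℂ] ℂ)

/-- The values of `‖ℓ g‖` over all `g` dominated by `f`. -/
def variationSet (f : C_c(ℝ, ℝ≥0)) : Set ℝ≥0 :=
  {r | ∃ g : C₀(ℝ, ℂ), (∀ x, ‖g x‖₊ ≤ f x) ∧ r = ‖ℓ g‖₊}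

/-- The total variation of `ℓ`. -/
noncomputable def variation (f : C_c(ℝ, ℝ≥0)) : ℝ≥0 := sSup (variationSet ℓ f)

theorem variation_le {f : C_c(ℝ, ℝ≥0)} {C : ℝ≥0}
    (h : ∀ g : C₀(ℝ, ℂ), (∀ x, ‖g x‖₊ ≤ f x) → ‖ℓ g‖₊ ≤ C) : variation ℓ f ≤ C := by
  refine csSup_le ⟨0, 0, by simp, by simp⟩ ?_
  rintro _ ⟨g, hg, rfl⟩
  exact h g hg

theorem nnnorm_le_mul_of_le {f : C_c(ℝ, ℝ≥0)} {C : ℝ≥0} (hC : ∀ x, f x ≤ C) {g : C₀(ℝ, ℂ)}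
    (hg : ∀ x, ‖g x‖₊ ≤ f x) : ‖ℓ g‖₊ ≤ ‖ℓ‖₊ * C := by
  refine (ℓ.le_opNNNorm g).trans ?_
  gcongr
  exact norm_zeroAtInfty_le C.2 fun x => (hg x).trans (hC x)

theorem bddAbove_variationSet (f : C_c(ℝ, ℝ≥0)) : BddAbove (variationSet ℓ f) := by
  obtain ⟨C, hC⟩ := f.continuous.bddAbove_range_of_hasCompactSupport f.hasCompactSupport
  refine ⟨‖ℓ‖₊ * C, ?_⟩
  rintro _ ⟨g, hg, rfl⟩
  exact nnnorm_le_mul_of_le ℓ (fun x => hC ⟨x, rfl⟩) hg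

theorem le_variation {f : C_c(ℝ, ℝ≥0)} {g : C₀(ℝ, ℂ)} (hg : ∀ x, ‖g x‖₊ ≤ f x) :
    ‖ℓ g‖₊ ≤ variation ℓ f :=
  le_csSup (bddAbove_variationSet ℓ f) ⟨g, hg, rfl⟩

theorem variation_smul_le {c : ℝ≥0} (hc : c ≠ 0) (f : C_c(ℝ, ℝ≥0)) :
    variation ℓ (c • f) ≤ c * variation ℓ f := by
  refine variation_le ℓ fun g hg => ?_
  have hcc : ((c : ℝ) : ℂ) ≠ 0 := by exact_mod_cast hc
  have hcn : ‖((c : ℝ) : ℂ)‖₊ = c := by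
    ext
    simp
  have h1 := le_variation ℓ (f := f) (g := ((c : ℝ) : ℂ)⁻¹ • g) fun x => by
    have := hg x
    simp only [CompactlySupportedContinuousMap.smul_apply, smul_eq_mul] at this
    rw [ZeroAtInftyContinuousMap.smul_apply, nnnorm_smul, nnnorm_inv, hcn]
    rwa [inv_mul_le_iff₀ (pos_iff_ne_zero.2 hc)]
  rw [map_smul, nnnorm_smul, nnnorm_inv, hcn, inv_mul_le_iff₀ (pos_iff_ne_zero.2 hc)] at h1
  exact h1

theorem variation_smul (c : ℝ≥0) (f : C_c(ℝ, ℝ≥0)) :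
    variation ℓ (c • f) = c * variation ℓ f := by
  rcases eq_or_ne c 0 with rfl | hc
  · rw [zero_mul, ← nonpos_iff_eq_zero]
    refine variation_le ℓ fun g hg => ?_
    have : g = 0 := by
      ext x
      simpa using hg x
    simp [this]
  · refine le_antisymm (variation_smul_le ℓ hc f) ?_
    have h := variation_smul_le ℓ (inv_ne_zero hc) (c • f)
    rw [smul_smul, inv_mul_cancel₀ hc, one_smul] at h
    rwa [← le_inv_mul_iff₀ (pos_iff_ne_zero.2 hc)]

theorem exists_norm_eq_one_mul_eq_norm (z : ℂ) : ∃ c : ℂ, ‖c‖₊ = 1 ∧ c * z = (‖z‖ : ℂ) := by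
  rcases eq_or_ne z 0 with rfl | hz
  · exact ⟨1, by simp, by simp⟩
  · refine ⟨(starRingEnd ℂ z) / ‖z‖, ?_, ?_⟩
    · ext
      simp [hz]
    · have : (‖z‖ : ℂ) ≠ 0 := by simpa using hz
      rw [div_mul_eq_mul_div, Complex.conj_mul', sq]
      field_simp

/-- A function dominated by f₁ + f₂ is split in the proportion f₁ : f₂. Continuity of the pieces is
an issue only where f₁ + f₂ = 0; there `g` vanishes, and each piece is dominated by `g`. -/
theorem variation_add_le (f₁ f₂ : C_c(ℝ, ℝ≥0)) :
    variation ℓ (f₁ + f₂) ≤ variation ℓ f₁ + variation ℓ f₂ := by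
  refine variation_le ℓ fun g hg => ?_
  have hg' : ∀ x, ‖g x‖₊ ≤ f₁ x + f₂ x := fun x => by simpa using hg x
  have hgc : Continuous g := continuous_zeroAtInfty g
  have key : ∀ a b : C_c(ℝ, ℝ≥0), (∀ x, ‖g x‖₊ ≤ a x + b x) →
      ∃ g₁ : C₀(ℝ, ℂ), ∀ x, g₁ x = ((a x / (a x + b x) : ℝ≥0) : ℂ) * g x := by
    intro a b hab
    have hle : ∀ x, ‖((a x / (a x + b x) : ℝ≥0) : ℂ) * g x‖ ≤ ‖g x‖ := fun x => by
      rw [norm_mul]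
      refine mul_le_of_le_one_left (norm_nonneg _) ?_
      rw [Complex.norm_real, Real.norm_eq_abs, NNReal.abs_eq]
      exact_mod_cast div_le_one_of_le₀ le_self_add zero_le
    refine ⟨zeroAtInftyOfNormLe (fun x => ((a x / (a x + b x) : ℝ≥0) : ℂ) * g x) ?_ g hle,
      fun x => rfl⟩
    rw [continuous_iff_continuousAt]
    intro x
    rcases eq_or_ne (a x + b x) 0 with h0 | h0
    · have hgx : g x = 0 := by simpa [h0] using hab x
      have : Tendsto g (𝓝 x) (𝓝 0) := hgx ▸ hgc.tendsto x
      unfold ContinuousAt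
      simp only [hgx, mul_zero]
      exact squeeze_zero_norm hle (by simpa using this.norm)
    · refine ContinuousAt.mul ?_ hgc.continuousAt
      have h1 : ContinuousAt (fun x => a x / (a x + b x)) x :=
        a.continuous.continuousAt.div (a.continuous.add b.continuous).continuousAt h0
      exact Complex.continuous_ofReal.continuousAt.comp
        (NNReal.continuous_coe.continuousAt.comp h1)
  obtain ⟨g₁, hg₁⟩ := key f₁ f₂ hg'
  obtain ⟨g₂, hg₂⟩ := key f₂ f₁ fun x => (hg' x).trans_eq (add_comm _ _)
  -- Where p + q = 0 the quotient is 0 by convention, which is harmless because `g` vanishes there.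
  have hdom : ∀ (p q r : ℝ≥0), r ≤ p + q → p / (p + q) * r ≤ p := fun p q r h => by
    rcases eq_or_ne (p + q) 0 with h0 | h0
    · rw [h0, div_zero, zero_mul]
      exact zero_le
    · rw [div_mul_eq_mul_div, div_le_iff₀ (pos_iff_ne_zero.2 h0)]
      gcongr
  have hsum : g = g₁ + g₂ := by
    ext x
    rw [ZeroAtInftyContinuousMap.add_apply, hg₁, hg₂, ← add_mul]
    rcases eq_or_ne (f₁ x + f₂ x) 0 with h0 | h0
    · have : g x = 0 := by simpa [h0] using hg' x
      simp [this]
    · rw [add_comm (f₂ x), ← Complex.ofReal_add, ← NNReal.coe_add, ← add_div, div_self h0]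
      simp
  rw [hsum, map_add]
  refine (nnnorm_add_le _ _).trans (add_le_add ?_ ?_)
  · refine le_variation ℓ fun x => ?_
    rw [hg₁, nnnorm_mul, show ‖((f₁ x / (f₁ x + f₂ x) : ℝ≥0) : ℂ)‖₊ = f₁ x / (f₁ x + f₂ x) from
      NNReal.eq (by rw [coe_nnnorm, Complex.norm_real, Real.norm_eq_abs, NNReal.abs_eq])]
    exact hdom _ _ _ (hg' x)
  · refine le_variation ℓ fun x => ?_
    rw [hg₂, nnnorm_mul, show ‖((f₂ x / (f₂ x + f₁ x) : ℝ≥0) : ℂ)‖₊ = f₂ x / (f₂ x + f₁ x) from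
      NNReal.eq (by rw [coe_nnnorm, Complex.norm_real, Real.norm_eq_abs, NNReal.abs_eq])]
    exact hdom _ _ _ ((hg' x).trans_eq (add_comm _ _))

/-- Unimodular factors make ℓ g₁ and ℓ g₂ nonnegative without affecting the domination, so the two
absolute values add up in a single competitor for f₁ + f₂. -/
theorem le_variation_add (f₁ f₂ : C_c(ℝ, ℝ≥0)) :
    variation ℓ f₁ + variation ℓ f₂ ≤ variation ℓ (f₁ + f₂) := by
  have h : ∀ g₁ g₂ : C₀(ℝ, ℂ), (∀ x, ‖g₁ x‖₊ ≤ f₁ x) → (∀ x, ‖g₂ x‖₊ ≤ f₂ x) →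
      ‖ℓ g₁‖₊ + ‖ℓ g₂‖₊ ≤ variation ℓ (f₁ + f₂) := fun g₁ g₂ h₁ h₂ => by
    obtain ⟨c₁, hc₁, e₁⟩ := exists_norm_eq_one_mul_eq_norm (ℓ g₁)
    obtain ⟨c₂, hc₂, e₂⟩ := exists_norm_eq_one_mul_eq_norm (ℓ g₂)
    have := le_variation ℓ (f := f₁ + f₂) (g := c₁ • g₁ + c₂ • g₂) fun x => by
      refine (nnnorm_add_le _ _).trans (add_le_add ?_ ?_)
      · simpa [nnnorm_mul, hc₁] using h₁ x
      · simpa [nnnorm_mul, hc₂] using h₂ x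
    refine le_trans (le_of_eq ?_) this
    rw [map_add, map_smul, map_smul, smul_eq_mul, smul_eq_mul, e₁, e₂, ← Complex.ofReal_add]
    ext
    rw [coe_nnnorm, Complex.norm_real, Real.norm_eq_abs, abs_of_nonneg (by positivity)]
    rfl
  have h' : ∀ g₂ : C₀(ℝ, ℂ), (∀ x, ‖g₂ x‖₊ ≤ f₂ x) →
      variation ℓ f₁ + ‖ℓ g₂‖₊ ≤ variation ℓ (f₁ + f₂) := fun g₂ h₂ => by
    have h0 := h 0 g₂ (by simp) h₂
    rw [map_zero, nnnorm_zero, zero_add] at h0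
    rw [← le_tsub_iff_right h0]
    exact variation_le ℓ fun g₁ h₁ => le_tsub_of_add_le_right (h g₁ g₂ h₁ h₂)
  have h0 := h' 0 (by simp)
  rw [map_zero, nnnorm_zero, add_zero] at h0
  rw [← le_tsub_iff_left h0]
  exact variation_le ℓ fun g₂ h₂ => le_tsub_of_add_le_left (h' g₂ h₂)

/-- The total variation as a positive linear functional. -/
noncomputable def variationLinear : C_c(ℝ, ℝ≥0) →ₗ[ℝ≥0] ℝ≥0 where
  toFun := variation ℓ
  map_add' f₁ f₂ := le_antisymm (variation_add_le ℓ f₁ f₂) (le_variation_add ℓ f₁ f₂)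
  map_smul' := variation_smul ℓ

/-- The total variation as a measure. -/
noncomputable def variationMeasure : Measure ℝ := NNRealRMK.rieszMeasure (variationLinear ℓ)

theorem lintegral_variationMeasure (f : C_c(ℝ, ℝ≥0)) :
    ∫⁻ x, f x ∂variationMeasure ℓ = variation ℓ f :=
  NNRealRMK.lintegral_rieszMeasure _ f

/-- A cutoff function: equal to `1` on `[-n, n]`, with values in `[0, 1]`. -/
theorem exists_cutoff (n : ℝ) : ∃ χ : C_c(ℝ, ℝ≥0), (∀ x, χ x ≤ 1) ∧ ∀ x, |x| ≤ n → χ x = 1 := by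
  have hc : Continuous fun x : ℝ => min 1 (Real.toNNReal (n + 1 - |x|)) := by fun_prop
  refine ⟨⟨⟨_, hc⟩, ?_⟩, fun x => min_le_left _ _, fun x hx => ?_⟩
  · refine HasCompactSupport.intro (isCompact_Icc (a := -(n + 1)) (b := n + 1)) fun x hx => ?_
    have : n + 1 < |x| := by
      by_contra h
      exact hx (abs_le.1 (not_lt.1 h))
    simp only [Real.toNNReal_of_nonpos (show n + 1 - |x| ≤ 0 by linarith)]
    simp
  · refine min_eq_left ?_
    rw [Real.one_le_toNNReal]
    linarith

theorem variationMeasure_univ_le : variationMeasure ℓ Set.univ ≤ ‖ℓ‖₊ := by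
  have hU : (Set.univ : Set ℝ) = ⋃ n : ℕ, Set.Icc (-(n : ℝ)) n := by
    refine (Set.eq_univ_of_forall fun x => ?_).symm
    obtain ⟨n, hn⟩ := exists_nat_ge |x|
    exact Set.mem_iUnion.2 ⟨n, abs_le.1 hn⟩
  have hmono : Monotone fun n : ℕ => Set.Icc (-(n : ℝ)) n := fun a b hab =>
    Set.Icc_subset_Icc (by simpa using hab) (by simpa using hab)
  rw [hU, hmono.measure_iUnion]
  refine iSup_le fun n => ?_
  obtain ⟨χ, h1, h2⟩ := exists_cutoff n
  calc variationMeasure ℓ (Set.Icc (-(n : ℝ)) n)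
      = ∫⁻ x in Set.Icc (-(n : ℝ)) n, 1 ∂variationMeasure ℓ := by simp
    _ ≤ ∫⁻ x in Set.Icc (-(n : ℝ)) n, χ x ∂variationMeasure ℓ := by
        refine setLIntegral_mono' measurableSet_Icc fun x hx => ?_
        rw [h2 x (abs_le.2 hx)]
        simp
    _ ≤ ∫⁻ x, χ x ∂variationMeasure ℓ := setLIntegral_le_lintegral _ _
    _ = variation ℓ χ := lintegral_variationMeasure ℓ χ
    _ ≤ ‖ℓ‖₊ := by
        refine ENNReal.coe_le_coe.2 (variation_le ℓ fun g hg => ?_)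
        simpa using nnnorm_le_mul_of_le ℓ h1 hg

instance isFiniteMeasure_variationMeasure : IsFiniteMeasure (variationMeasure ℓ) :=
  ⟨(variationMeasure_univ_le ℓ).trans_lt ENNReal.coe_lt_top⟩

theorem integrable_zeroAtInfty {ν : Measure ℝ} [IsFiniteMeasure ν] (g : C₀(ℝ, ℂ)) :
    Integrable g ν :=
  Integrable.of_bound (continuous_zeroAtInfty g).aestronglyMeasurable ‖g‖
    (Eventually.of_forall fun x => norm_apply_le g x)

/-- A function cut off to compact support is a competitor for its own absolute value in the
variation. The rest, (1 − χ) g, is uniformly small and is controlled by ‖ℓ‖. -/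
theorem norm_apply_le_integral (g : C₀(ℝ, ℂ)) : ‖ℓ g‖ ≤ ∫ x, ‖g x‖ ∂variationMeasure ℓ := by
  have hgc := continuous_zeroAtInfty g
  refine le_of_forall_pos_le_add fun ε hε => ?_
  obtain ⟨δ, hδ, hδε⟩ : ∃ δ > 0, ‖ℓ‖ * δ ≤ ε :=
    ⟨ε / (‖ℓ‖ + 1), by positivity, by
      rw [mul_div_assoc', div_le_iff₀ (by positivity)]
      nlinarith [norm_nonneg ℓ]⟩
  obtain ⟨n, hn⟩ : ∃ n : ℝ, ∀ x, n < |x| → ‖g x‖ < δ := by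
    have h1 := g.zero_at_infty'.norm
    rw [norm_zero] at h1
    have h2 := h1.eventually (gt_mem_nhds hδ)
    rw [← Metric.cobounded_eq_cocompact, ← comap_norm_atTop (E := ℝ), eventually_comap] at h2
    obtain ⟨n, hn⟩ := (eventually_atTop).1 h2
    exact ⟨n, fun x hx => hn _ hx.le x rfl⟩
  obtain ⟨χ, h1, h2⟩ := exists_cutoff n
  have hχc : Continuous fun x => ((χ x : ℝ) : ℂ) := by
    have := χ.continuous
    fun_prop
  have hχn : ∀ x, ‖((χ x : ℝ) : ℂ)‖₊ = χ x := fun x =>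
    NNReal.eq (by rw [coe_nnnorm, Complex.norm_real, Real.norm_eq_abs, NNReal.abs_eq])
  let g₁ : C₀(ℝ, ℂ) := zeroAtInftyOfNormLe (fun x => ((χ x : ℝ) : ℂ) * g x) (hχc.mul hgc) g
    fun x => by
      rw [norm_mul]
      refine mul_le_of_le_one_left (norm_nonneg _) ?_
      have := h1 x
      rw [← hχn] at this
      exact this
  have hg₁ : ∀ x, g₁ x = ((χ x : ℝ) : ℂ) * g x := fun x => rfl
  let f : C_c(ℝ, ℝ≥0) := ⟨⟨fun x => χ x * ‖g x‖₊, χ.continuous.mul hgc.nnnorm⟩,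
    χ.hasCompactSupport.mul_right⟩
  have hf : ∀ x, f x = χ x * ‖g x‖₊ := fun x => rfl
  have e1 : ‖ℓ g₁‖ ≤ ∫ x, ‖g x‖ ∂variationMeasure ℓ := by
    have h3 : ‖ℓ g₁‖₊ ≤ variation ℓ f := le_variation ℓ fun x => by
      rw [hg₁, nnnorm_mul, hχn, hf]
    have h4 : ((‖ℓ g₁‖₊ : ℝ≥0) : ℝ≥0∞) ≤ ∫⁻ x, ‖g x‖ₑ ∂variationMeasure ℓ := by
      refine (ENNReal.coe_le_coe.2 h3).trans ?_
      rw [← lintegral_variationMeasure]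
      refine lintegral_mono fun x => ?_
      rw [hf]
      refine ENNReal.coe_le_coe.2 ?_
      exact mul_le_of_le_one_left zero_le (h1 x)
    rw [integral_norm_eq_lintegral_enorm hgc.aestronglyMeasurable]
    have h5 := ENNReal.toReal_mono (integrable_zeroAtInfty g).2.ne h4
    simpa using h5
  have e2 : ‖ℓ (g - g₁)‖ ≤ ε := by
    refine (ℓ.le_opNorm _).trans (le_trans ?_ hδε)
    gcongr
    refine norm_zeroAtInfty_le hδ.le fun x => ?_
    rw [ZeroAtInftyContinuousMap.sub_apply, hg₁]
    rcases le_or_gt |x| n with hx | hx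
    · simp [h2 x hx, hδ.le]
    · refine le_trans ?_ (hn x hx).le
      rw [show g x - ((χ x : ℝ) : ℂ) * g x = ((1 - χ x : ℝ) : ℂ) * g x by push_cast; ring,
        norm_mul, Complex.norm_real, Real.norm_eq_abs]
      refine mul_le_of_le_one_left (norm_nonneg _) ?_
      have h6 : (χ x : ℝ) ≤ 1 := by exact_mod_cast h1 x
      rw [abs_le]
      constructor <;> linarith [(χ x).2]
  calc ‖ℓ g‖ = ‖ℓ g₁ + ℓ (g - g₁)‖ := by rw [← map_add]; simp
    _ ≤ _ := (norm_add_le _ _).trans (add_le_add e1 e2)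

/-- The functional on `L¹(|ℓ|)` extending `ℓ`. -/
theorem exists_extension_L1 : ∃ F : Lp ℂ 1 (variationMeasure ℓ) →L[ℂ] ℂ, ‖F‖ ≤ 1 ∧
    ∀ g : C₀(ℝ, ℂ), F ((integrable_zeroAtInfty g).toL1 g) = ℓ g := by
  let ι : C₀(ℝ, ℂ) →ₗ[ℂ] Lp ℂ 1 (variationMeasure ℓ) :=
    { toFun := fun g => (integrable_zeroAtInfty g).toL1 g
      map_add' := fun g g' => rfl
      map_smul' := fun c g => rfl }
  have hι : ∀ g, ‖ℓ g‖ ≤ ‖ι g‖ := fun g => by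
    refine (norm_apply_le_integral ℓ g).trans_eq ?_
    have : ‖ι g‖ = ∫ x, ‖ι g x‖ ∂variationMeasure ℓ := L1.norm_eq_integral_norm _
    rw [this]
    refine integral_congr_ae ?_
    filter_upwards [Integrable.coeFn_toL1 (integrable_zeroAtInfty (ν := variationMeasure ℓ) g)]
      with x hx
    rw [← hx]
    rfl
  -- The map into L¹ need not be injective, as the measure may lack full support. By `hι`, ℓ still
  -- factors through its range, from where Hahn–Banach extends it.
  have hker : LinearMap.ker ι ≤ LinearMap.ker (ℓ : C₀(ℝ, ℂ) →ₗ[ℂ] ℂ) := fun g hg => by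
    have h1 : ι g = 0 := hg
    have h2 := hι g
    rw [h1, norm_zero] at h2
    exact norm_le_zero_iff.1 h2
  let L : LinearMap.range ι →ₗ[ℂ] ℂ :=
    ((LinearMap.ker ι).liftQ (ℓ : C₀(ℝ, ℂ) →ₗ[ℂ] ℂ) hker).comp
      (ι.quotKerEquivRange.symm : LinearMap.range ι →ₗ[ℂ] C₀(ℝ, ℂ) ⧸ LinearMap.ker ι)
  have hL : ∀ g (hg : ι g ∈ LinearMap.range ι), L ⟨ι g, hg⟩ = ℓ g := fun g hg => by
    have : ι.quotKerEquivRange.symm ⟨ι g, hg⟩ = Submodule.Quotient.mk g := by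
      rw [LinearEquiv.symm_apply_eq]
      rfl
    simp [L, this]
  have hLb : ∀ y, ‖L y‖ ≤ 1 * ‖y‖ := by
    rintro ⟨y, hy⟩
    obtain ⟨g, rfl⟩ := LinearMap.mem_range.1 hy
    rw [hL, one_mul]
    exact hι g
  obtain ⟨F, hF, hFn⟩ := exists_extension_norm_eq (LinearMap.range ι) (L.mkContinuous 1 hLb)
  refine ⟨F, hFn.trans_le (LinearMap.mkContinuous_norm_le _ zero_le_one _), fun g => ?_⟩
  exact (hF ⟨ι g, g, rfl⟩).trans (hL g _)

/-- A functional of norm at most one on `L¹(ν)`, `ν` finite, is given by a density. -/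
theorem exists_density {ν : Measure ℝ} [IsFiniteMeasure ν] (F : Lp ℂ 1 ν →L[ℂ] ℂ)
    (hF : ‖F‖ ≤ 1) : ∃ h : ℝ → ℂ, Measurable h ∧ Integrable h ν ∧
      (∀ (y : ℝ → ℂ) (hy : MemLp y 2 ν), F ((hy.integrable (by norm_num)).toL1 y) =
        ∫ x, y x * h x ∂ν) ∧ ∫ x, ‖h x‖ ∂ν ≤ ν.real Set.univ := by
  -- Since ν is finite, L² ⊆ L¹; on the Hilbert space L² the functional is an inner product, which
  -- supplies the density.
  let J : Lp ℂ 2 ν →ₗ[ℂ] ℂ :=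
    { toFun := fun y => F (((Lp.memLp y).integrable (by norm_num)).toL1 y)
      map_add' := fun y y' => by
        rw [← map_add, ← Integrable.toL1_add]
        congr 1
        exact (Integrable.toL1_eq_toL1_iff _ _ _ _).2 (Lp.coeFn_add y y')
      map_smul' := fun c y => by
        rw [RingHom.id_apply, ← map_smul, ← Integrable.toL1_smul']
        congr 1
        exact (Integrable.toL1_eq_toL1_iff _ _ _ _).2 (Lp.coeFn_smul c y) }
  have hFle : ∀ (y : ℝ → ℂ) (hy : Integrable y ν), ‖F (hy.toL1 y)‖ ≤ ∫ x, ‖y x‖ ∂ν :=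
    fun y hy => by
      refine (F.le_of_opNorm_le hF _).trans_eq ?_
      rw [one_mul, L1.norm_eq_integral_norm]
      refine integral_congr_ae ?_
      filter_upwards [Integrable.coeFn_toL1 hy] with x hx
      rw [hx]
  obtain ⟨C, hC⟩ : ∃ C : ℝ, ∀ y, ‖J y‖ ≤ C * ‖y‖ := by
    refine ⟨((ν Set.univ) ^ (1 / (1 : ℝ≥0∞).toReal - 1 / (2 : ℝ≥0∞).toReal)).toReal, fun y => ?_⟩
    refine (hFle y ((Lp.memLp y).integrable (by norm_num))).trans ?_
    have h1 := eLpNorm_le_eLpNorm_mul_rpow_measure_univ (p := 1) (q := 2) (by norm_num)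
      (Lp.memLp y).1
    rw [integral_norm_eq_lintegral_enorm (Lp.memLp y).1, ← eLpNorm_one_eq_lintegral_enorm,
      mul_comm, Lp.norm_def, ← ENNReal.toReal_mul]
    refine ENNReal.toReal_mono (ENNReal.mul_ne_top (Lp.memLp y).2.ne ?_) h1
    exact ENNReal.rpow_ne_top_of_nonneg (by norm_num) (measure_ne_top _ _)
  set v : Lp ℂ 2 ν := (InnerProductSpace.toDual ℂ _).symm (J.mkContinuous C hC) with hv
  have hvi : Integrable v ν := (Lp.memLp v).integrable (by norm_num)
  set h : ℝ → ℂ := fun x => starRingEnd ℂ (v x) with hh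
  have hvm : Measurable v := (Lp.stronglyMeasurable v).measurable
  have hm : Measurable h := Complex.continuous_conj.measurable.comp hvm
  have hi : Integrable h ν := by
    refine hvi.mono hm.aestronglyMeasurable (Eventually.of_forall fun x => ?_)
    simp [hh]
  have hrep : ∀ (y : ℝ → ℂ) (hy : MemLp y 2 ν),
      F ((hy.integrable (by norm_num)).toL1 y) = ∫ x, y x * h x ∂ν := fun y hy => by
    have h1 : J (hy.toLp y) = inner ℂ v (hy.toLp y) := by
      rw [hv, InnerProductSpace.toDual_symm_apply]
      rfl
    have h2 : J (hy.toLp y) = F ((hy.integrable (by norm_num)).toL1 y) := by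
      change F _ = _
      congr 1
      exact (Integrable.toL1_eq_toL1_iff _ _ _ _).2 hy.coeFn_toLp
    rw [← h2, h1, L2.inner_def]
    refine integral_congr_ae ?_
    filter_upwards [hy.coeFn_toLp] with x hx
    rw [hx, RCLike.inner_apply]
  refine ⟨h, hm, hi, hrep, ?_⟩
  -- The phase for which y h = |h|; being bounded by 1 it may be inserted into the representation.
  set y : ℝ → ℂ := fun x => v x / (‖v x‖ : ℂ) with hy
  have hyn : ∀ x, ‖y x‖ ≤ 1 := fun x => by
    simp only [hy, norm_div, Complex.norm_real, norm_norm]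
    exact div_self_le_one _
  have hym : Measurable y := hvm.div (Complex.measurable_ofReal.comp hvm.norm)
  have hyL : MemLp y 2 ν := MemLp.of_bound hym.aestronglyMeasurable 1 (Eventually.of_forall hyn)
  have e1 : ∫ x, y x * h x ∂ν = ((∫ x, ‖h x‖ ∂ν : ℝ) : ℂ) := by
    rw [← integral_complex_ofReal]
    refine integral_congr_ae (Eventually.of_forall fun x => ?_)
    simp only [hy, hh, RCLike.norm_conj]
    rcases eq_or_ne (v x) 0 with h0 | h0
    · simp [h0]
    · have : (‖v x‖ : ℂ) ≠ 0 := by simpa using h0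
      rw [div_mul_eq_mul_div, Complex.mul_conj', sq]
      field_simp
  have e2 := hFle y (hyL.integrable (by norm_num))
  rw [hrep y hyL, e1, Complex.norm_real, Real.norm_eq_abs,
    abs_of_nonneg (integral_nonneg fun x => norm_nonneg _)] at e2
  refine e2.trans ?_
  calc ∫ x, ‖y x‖ ∂ν ≤ ∫ _, (1 : ℝ) ∂ν :=
        integral_mono (hyL.integrable (by norm_num)).norm (integrable_const _) hyn
    _ = _ := by simp

/-- The **Riesz representation theorem** for the dual of `C₀(ℝ, ℂ)`. -/
theorem exists_measure_density : ∃ (ν : Measure ℝ) (h : ℝ → ℂ), IsFiniteMeasure ν ∧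
    Measurable h ∧ Integrable h ν ∧ (∀ g : C₀(ℝ, ℂ), ℓ g = ∫ x, g x * h x ∂ν) ∧
    ∫ x, ‖h x‖ ∂ν ≤ ‖ℓ‖ := by
  obtain ⟨F, hF, hFℓ⟩ := exists_extension_L1 ℓ
  obtain ⟨h, hm, hi, hrep, hle⟩ := exists_density F hF
  refine ⟨variationMeasure ℓ, h, inferInstance, hm, hi, fun g => ?_, hle.trans ?_⟩
  · rw [← hFℓ g]
    exact hrep g (MemLp.of_bound (continuous_zeroAtInfty g).aestronglyMeasurable ‖g‖
      (Eventually.of_forall fun x => norm_apply_le g x))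
  · exact ENNReal.toReal_mono ENNReal.coe_ne_top (variationMeasure_univ_le ℓ)

end Riesz

/-! ### A theorem of F. and M. Riesz type -/

section LaplacePowers

variable {ν : Measure ℝ} {h a : ℝ → ℂ}

/-- The Fourier–Laplace transform of a function on the half-line. -/
noncomputable def halfLineTransform (a : ℝ → ℂ) (x : ℝ) : ℂ :=
  ∫ s in Set.Ioi (0 : ℝ), a s * Complex.exp (-(Complex.I * x * s))

theorem norm_halfLineTransform_le (a : ℝ → ℂ) (x : ℝ) :
    ‖halfLineTransform a x‖ ≤ ∫ s in Set.Ioi (0 : ℝ), ‖a s‖ := by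
  refine (norm_integral_le_integral_norm _).trans_eq ?_
  simp [norm_cexp_neg_I_mul]

theorem continuous_halfLineTransform (ha : IntegrableOn a (Set.Ioi 0)) :
    Continuous (halfLineTransform a) :=
  continuous_integral_mul_cexp ha

theorem integrable_mul_halfLineTransform_pow (hh : Integrable h ν)
    (ha : IntegrableOn a (Set.Ioi 0)) (p : ℕ) :
    Integrable (fun x => h x * halfLineTransform a x ^ p) ν := by
  refine hh.mul_bdd (c := (∫ s in Set.Ioi (0 : ℝ), ‖a s‖) ^ p)
    ((continuous_halfLineTransform ha).pow p).aestronglyMeasurable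
    (Eventually.of_forall fun x => ?_)
  rw [norm_pow]
  gcongr
  exact norm_halfLineTransform_le a x

variable [IsFiniteMeasure ν]

/-- By Fubini, an extra factor `halfLineTransform a` replaces the transform at s by a weighted
average of its values at s + t, t > 0. Only the half-line to the right of s is involved, so decay
there survives. -/
theorem integral_mul_pow_succ_mul_cexp (hh : Integrable h ν) (ha : IntegrableOn a (Set.Ioi 0))
    (p : ℕ) (s : ℝ) :
    ∫ x, h x * halfLineTransform a x ^ (p + 1) * Complex.exp (-(Complex.I * s * x)) ∂ν =
      ∫ t in Set.Ioi (0 : ℝ), a t *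
        ∫ x, h x * halfLineTransform a x ^ p *
          Complex.exp (-(Complex.I * ((s + t : ℝ) : ℂ) * x)) ∂ν := by
  have hi := integrable_mul_halfLineTransform_pow hh ha p
  have hint : Integrable (Function.uncurry fun (x : ℝ) (t : ℝ) =>
      (h x * halfLineTransform a x ^ p) * a t *
        Complex.exp (-(Complex.I * ((s + t : ℝ) : ℂ) * x)))
      (ν.prod (volume.restrict (Set.Ioi (0 : ℝ)))) := by
    refine ((hi.mul_prod ha).mul_bdd (c := 1)
      (g := fun q : ℝ × ℝ => Complex.exp (-(Complex.I * ((s + q.2 : ℝ) : ℂ) * q.1)))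
      (by fun_prop) (Eventually.of_forall fun q => ?_))
    rw [norm_cexp_neg_I_mul]
  calc ∫ x, h x * halfLineTransform a x ^ (p + 1) * Complex.exp (-(Complex.I * s * x)) ∂ν
      = ∫ x, (∫ t in Set.Ioi (0 : ℝ), (h x * halfLineTransform a x ^ p) * a t *
        Complex.exp (-(Complex.I * ((s + t : ℝ) : ℂ) * x))) ∂ν := by
        refine integral_congr_ae (Eventually.of_forall fun x => ?_)
        simp only
        rw [pow_succ, show h x * (halfLineTransform a x ^ p * halfLineTransform a x) *
          Complex.exp (-(Complex.I * s * x)) = (h x * halfLineTransform a x ^ p *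
          Complex.exp (-(Complex.I * s * x))) * halfLineTransform a x by ring]
        conv_lhs => rw [halfLineTransform]
        rw [halfLineTransform, ← integral_const_mul]
        refine integral_congr_ae (Eventually.of_forall fun t => ?_)
        simp only
        rw [show -(Complex.I * ((s + t : ℝ) : ℂ) * x) =
          -(Complex.I * s * x) + -(Complex.I * x * t) by push_cast; ring, Complex.exp_add]
        ring
    _ = ∫ t in Set.Ioi (0 : ℝ), ∫ x, (h x * halfLineTransform a x ^ p) * a t *
        Complex.exp (-(Complex.I * ((s + t : ℝ) : ℂ) * x)) ∂ν := integral_integral_swap hint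
    _ = _ := by
        refine integral_congr_ae (Eventually.of_forall fun t => ?_)
        simp only
        rw [← integral_const_mul]
        refine integral_congr_ae (Eventually.of_forall fun x => ?_)
        simp only
        ring

theorem setIntegral_Ioi_comp_add_left (f : ℝ → ℝ) (s : ℝ) :
    ∫ t in Set.Ioi (0 : ℝ), f (s + t) = ∫ r in Set.Ioi s, f r := by
  have h := (measurePreserving_add_left volume s).setIntegral_preimage_emb
    (measurableEmbedding_addLeft s) f (Set.Ioi s)
  rw [← h]
  congr 2
  ext t
  simp

theorem integral_exp_neg_half : ∫ t in Set.Ioi (0 : ℝ), Real.exp (-t / 2) = 2 := by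
  have := integral_exp_mul_Ioi (a := -(1 / 2)) (by norm_num) 0
  simp only [mul_zero, Real.exp_zero] at this
  convert this using 1
  · congr 1
    funext t
    congr 1
    ring
  · norm_num

theorem integrableOn_exp_neg_half : IntegrableOn (fun t : ℝ => Real.exp (-t / 2)) (Set.Ioi 0) := by
  refine (exp_neg_integrableOn_Ioi 0 (b := 1 / 2) (by norm_num)).congr_fun (fun t _ => ?_)
    measurableSet_Ioi
  ring_nf

/-- Exponential decay of the Fourier transform on a half-line is inherited by the products with
powers of a half-line transform. -/
theorem norm_integral_mul_pow_succ_le (hh : Integrable h ν) (ha : IntegrableOn a (Set.Ioi 0))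
    {σ : ℝ} (hσ : 0 ≤ σ) (haσ : ∀ s, 0 < s → ‖a s‖ ≤ σ)
    (hT : IntegrableOn (fun s : ℝ => Real.exp (s / 2) *
      ‖∫ x, h x * Complex.exp (-(Complex.I * s * x)) ∂ν‖) (Set.Ioi 0)) (p : ℕ) {s : ℝ}
    (hs : 0 ≤ s) :
    ‖∫ x, h x * halfLineTransform a x ^ (p + 1) * Complex.exp (-(Complex.I * s * x)) ∂ν‖ ≤
      (∫ s in Set.Ioi (0 : ℝ), Real.exp (s / 2) *
        ‖∫ x, h x * Complex.exp (-(Complex.I * s * x)) ∂ν‖) * σ * (2 * σ) ^ p *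
        Real.exp (-s / 2) := by
  set C := ∫ s in Set.Ioi (0 : ℝ), Real.exp (s / 2) *
        ‖∫ x, h x * Complex.exp (-(Complex.I * s * x)) ∂ν‖ with hC
  induction p generalizing s with
  | zero =>
    -- The first factor turns weighted integrability into a pointwise bound: ∫_s^∞ |T| ≤ e^{−s/2} C.
    set T : ℝ → ℂ := fun s => ∫ x, h x * Complex.exp (-(Complex.I * s * x)) ∂ν with hTdef
    have hTc : Continuous T := continuous_integral_mul_cexp hh
    have hle : ∀ r ∈ Set.Ioi s, ‖T r‖ ≤ Real.exp (-s / 2) * (Real.exp (r / 2) * ‖T r‖) :=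
      fun r hr => by
        have hr : s < r := hr
        rw [← mul_assoc, ← Real.exp_add]
        refine le_mul_of_one_le_left (norm_nonneg _) (Real.one_le_exp (by linarith))
    have hTs : IntegrableOn (fun r => Real.exp (-s / 2) * (Real.exp (r / 2) * ‖T r‖))
        (Set.Ioi s) := (hT.mono_set (Set.Ioi_subset_Ioi hs)).const_mul _
    have hTi : IntegrableOn (fun r => ‖T r‖) (Set.Ioi s) := by
      refine hTs.mono' hTc.norm.aestronglyMeasurable ?_
      refine (ae_restrict_iff' measurableSet_Ioi).2 (Eventually.of_forall fun r hr => ?_)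
      rw [norm_norm]
      exact hle r hr
    have hTi' : IntegrableOn (fun t => ‖T (s + t)‖) (Set.Ioi 0) := by
      have h1 := ((measurePreserving_add_left volume s).integrableOn_comp_preimage
        (measurableEmbedding_addLeft s)).2 hTi
      have h2 : (fun x => s + x) ⁻¹' Set.Ioi s = Set.Ioi 0 := by
        ext t
        simp
      rwa [h2] at h1
    rw [integral_mul_pow_succ_mul_cexp hh ha]
    simp only [pow_zero, mul_one]
    calc ‖∫ t in Set.Ioi (0 : ℝ), a t * T (s + t)‖
        ≤ ∫ t in Set.Ioi (0 : ℝ), σ * ‖T (s + t)‖ := by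
          refine norm_integral_le_of_norm_le (hTi'.const_mul σ) ?_
          refine (ae_restrict_iff' measurableSet_Ioi).2 (Eventually.of_forall fun t ht => ?_)
          rw [norm_mul]
          gcongr
          exact haσ t ht
      _ = σ * ∫ r in Set.Ioi s, ‖T r‖ := by
          rw [integral_const_mul, setIntegral_Ioi_comp_add_left fun r => ‖T r‖]
      _ ≤ σ * ∫ r in Set.Ioi s, Real.exp (-s / 2) * (Real.exp (r / 2) * ‖T r‖) := by
          gcongr ?_ * ?_
          exact setIntegral_mono_on hTi hTs measurableSet_Ioi hle
      _ ≤ σ * (Real.exp (-s / 2) * C) := by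
          rw [integral_const_mul]
          gcongr
          exact setIntegral_mono_set hT (Eventually.of_forall fun r => by positivity)
            (Set.Ioi_subset_Ioi hs).eventuallyLE
      _ = _ := by ring
  | succ p ih =>
    -- Each further factor costs σ ∫₀^∞ e^{−t/2} dt = 2σ.
    rw [integral_mul_pow_succ_mul_cexp hh ha]
    calc _ ≤ ∫ t in Set.Ioi (0 : ℝ),
          σ * (C * σ * (2 * σ) ^ p * Real.exp (-s / 2)) * Real.exp (-t / 2) := by
          refine norm_integral_le_of_norm_le (integrableOn_exp_neg_half.const_mul _) ?_
          refine (ae_restrict_iff' measurableSet_Ioi).2 (Eventually.of_forall fun t ht => ?_)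
          have ht : 0 < t := ht
          have h1 := ih (s := s + t) (by linarith)
          rw [norm_mul]
          calc _ ≤ σ * (C * σ * (2 * σ) ^ p * Real.exp (-(s + t) / 2)) :=
                mul_le_mul (haσ t ht) h1 (norm_nonneg _) hσ
            _ = _ := by
                rw [show -(s + t) / 2 = -s / 2 + -t / 2 by ring, Real.exp_add]
                ring
      _ = _ := by
          rw [integral_const_mul, integral_exp_neg_half]
          ring

/-- Expand the exponential. The term of order p + 1 is at most N^{p+1}/(p+1)! · C σ (2σ)^p, and
(p+1)! ≥ p! sums these to the bound. Its point is that it tends to 0 as σ → 0 with N fixed, no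
matter how large the L¹ norm of `a` is. -/
theorem norm_integral_mul_exp_sub_le (hh : Integrable h ν) (ha : IntegrableOn a (Set.Ioi 0))
    {σ : ℝ} (hσ : 0 ≤ σ) (haσ : ∀ s, 0 < s → ‖a s‖ ≤ σ)
    (hT : IntegrableOn (fun s : ℝ => Real.exp (s / 2) *
      ‖∫ x, h x * Complex.exp (-(Complex.I * s * x)) ∂ν‖) (Set.Ioi 0)) (N : ℕ) :
    ‖(∫ x, h x * Complex.exp (-(N * halfLineTransform a x)) ∂ν) - ∫ x, h x ∂ν‖ ≤
      (∫ s in Set.Ioi (0 : ℝ), Real.exp (s / 2) *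
        ‖∫ x, h x * Complex.exp (-(Complex.I * s * x)) ∂ν‖) * (N * σ) *
        Real.exp (2 * (N * σ)) := by
  set C := ∫ s in Set.Ioi (0 : ℝ), Real.exp (s / 2) *
        ‖∫ x, h x * Complex.exp (-(Complex.I * s * x)) ∂ν‖ with hC
  have hC0 : 0 ≤ C := integral_nonneg fun s => by positivity
  set A := ∫ s in Set.Ioi (0 : ℝ), ‖a s‖ with hA
  set G := halfLineTransform a with hG
  let F : ℕ → ℝ → ℂ := fun p x => ((-N : ℂ) ^ p / (p.factorial : ℂ)) * (h x * G x ^ p)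
  have hFi : ∀ p, Integrable (F p) ν := fun p =>
    (integrable_mul_halfLineTransform_pow hh ha p).const_mul _
  have hFn : ∀ p x, ‖F p x‖ ≤ ‖h x‖ * ((N * A) ^ p / p.factorial) := fun p x => by
    simp only [F, norm_mul, norm_div, norm_pow, norm_neg, Complex.norm_natCast]
    have : ‖G x‖ ^ p ≤ A ^ p := by
      gcongr
      exact norm_halfLineTransform_le a x
    calc (N : ℝ) ^ p / p.factorial * (‖h x‖ * ‖G x‖ ^ p)
        ≤ (N : ℝ) ^ p / p.factorial * (‖h x‖ * A ^ p) := by gcongr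
      _ = _ := by rw [mul_pow]; ring
  have hsum : Summable fun p => ∫ x, ‖F p x‖ ∂ν := by
    refine Summable.of_nonneg_of_le (fun p => integral_nonneg fun x => norm_nonneg _) (fun p => ?_)
      ((Real.summable_pow_div_factorial (N * A)).mul_left (∫ x, ‖h x‖ ∂ν))
    rw [← integral_mul_const]
    exact integral_mono (hFi p).norm (hh.norm.mul_const _) (hFn p)
  have h1 := hasSum_integral_of_summable_integral_norm hFi hsum
  have h2 : ∀ x, ∑' p, F p x = h x * Complex.exp (-(N * G x)) := fun x => by
    have := (NormedSpace.expSeries_div_hasSum_exp (-(N * G x) : ℂ)).mul_left (h x)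
    rw [← Complex.exp_eq_exp_ℂ] at this
    refine (this.congr_fun fun p => ?_).tsum_eq
    simp only [F]
    rw [show (-(N * G x) : ℂ) = (-N) * G x by ring, mul_pow]
    ring
  simp_rw [h2] at h1
  have h3 : ∫ x, F 0 x ∂ν = ∫ x, h x ∂ν := by simp [F]
  have h4 := (hasSum_nat_add_iff' 1).2 h1
  simp only [Finset.range_one, Finset.sum_singleton, h3] at h4
  rw [← h4.tsum_eq]
  have hexp := (NormedSpace.expSeries_div_hasSum_exp (2 * (N * σ) : ℝ)).mul_left (C * (N * σ))
  rw [← Real.exp_eq_exp_ℝ] at hexp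
  refine tsum_of_norm_bounded hexp fun p => ?_
  have h5 := norm_integral_mul_pow_succ_le hh ha hσ haσ hT p le_rfl
  simp only [Complex.ofReal_zero, mul_zero, zero_mul, neg_zero, Complex.exp_zero, mul_one,
    zero_div, Real.exp_zero] at h5
  simp only [F, integral_const_mul]
  rw [norm_mul, norm_div, norm_pow, norm_neg, Complex.norm_natCast, Complex.norm_natCast]
  calc (N : ℝ) ^ (p + 1) / ((p + 1).factorial : ℝ) * ‖∫ x, h x * G x ^ (p + 1) ∂ν‖
      ≤ (N : ℝ) ^ (p + 1) / (p.factorial : ℝ) * (C * σ * (2 * σ) ^ p) := by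
        gcongr
        · exact Nat.le_succ p
    _ = _ := by
        rw [mul_pow, mul_pow, mul_pow]
        ring

end LaplacePowers

/-! ### Cauchy integrals over shrinking neighbourhoods, and absolute continuity. -/

section RieszBrothers

/-- The Cauchy kernel, integrated over a set `U`. -/
noncomputable def cauchyIntegral (δ : ℝ) (U : Set ℝ) (x : ℝ) : ℂ :=
  ∫ c in U, ((δ : ℂ) + Complex.I * ((x - c : ℝ) : ℂ))⁻¹

theorem integral_exp_mul_cexp {δ : ℝ} (hδ : 0 < δ) (y : ℝ) :
    ∫ s in Set.Ioi (0 : ℝ), (Real.exp (-δ * s) : ℂ) * Complex.exp (-(Complex.I * y * s)) =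
      ((δ : ℂ) + Complex.I * y)⁻¹ := by
  have := integral_exp_mul_complex_Ioi (a := -((δ : ℂ) + Complex.I * y)) (by simpa using hδ) 0
  simp only [Complex.ofReal_zero, mul_zero, Complex.exp_zero, neg_div_neg_eq, one_div] at this
  rw [← this]
  refine integral_congr_ae (Eventually.of_forall fun s => ?_)
  simp only [Complex.ofReal_exp, ← Complex.exp_add]
  congr 1
  push_cast
  ring

/-- The Laplace density of the integrated Cauchy kernel. -/
noncomputable def cauchyDensity (δ : ℝ) (U : Set ℝ) (s : ℝ) : ℂ :=
  (Real.exp (-δ * s) : ℂ) * ∫ c in U, Complex.exp (Complex.I * c * s)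

theorem norm_setIntegral_cexp_le (U : Set ℝ) (hU : volume U ≠ ⊤) (s : ℝ) :
    ‖∫ c in U, Complex.exp (Complex.I * c * s)‖ ≤ volume.real U := by
  have := norm_setIntegral_le_of_norm_le_const (μ := volume) (s := U) hU.lt_top
    (f := fun c : ℝ => Complex.exp (Complex.I * c * s)) (C := 1)
    (fun c _ => (norm_cexp_I_mul c s).le)
  simpa using this

theorem norm_cauchyDensity_le {δ : ℝ} {U : Set ℝ} (hU : volume U ≠ ⊤) (s : ℝ) :
    ‖cauchyDensity δ U s‖ ≤ Real.exp (-δ * s) * volume.real U := by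
  rw [cauchyDensity, norm_mul, Complex.norm_real, Real.norm_eq_abs, Real.abs_exp]
  gcongr
  exact norm_setIntegral_cexp_le U hU s

theorem integrableOn_cauchyDensity {δ : ℝ} (hδ : 0 < δ) {U : Set ℝ} (hU : volume U ≠ ⊤) :
    IntegrableOn (cauchyDensity δ U) (Set.Ioi 0) := by
  have : IsFiniteMeasure (volume.restrict U) := isFiniteMeasure_restrict.2 hU
  have hc : Continuous fun s : ℝ => ∫ c in U, Complex.exp (Complex.I * c * s) := by
    refine continuous_of_dominated (bound := fun _ => 1) (fun s => ?_)
      (fun s => Eventually.of_forall fun c => (norm_cexp_I_mul c s).le) (integrable_const _)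
      (Eventually.of_forall fun c => by fun_prop)
    exact (by fun_prop : Continuous fun c : ℝ => Complex.exp (Complex.I * c * s)).aestronglyMeasurable
  refine ((exp_neg_integrableOn_Ioi 0 hδ).mul_const (volume.real U)).mono' ?_
    (Eventually.of_forall fun s => norm_cauchyDensity_le hU s)
  exact ((by fun_prop : Continuous fun s : ℝ => (Real.exp (-δ * s) : ℂ)).mul
    hc).aestronglyMeasurable

theorem halfLineTransform_cauchyDensity {δ : ℝ} (hδ : 0 < δ) {U : Set ℝ} (hU : volume U ≠ ⊤)
    (x : ℝ) : halfLineTransform (cauchyDensity δ U) x = cauchyIntegral δ U x := by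
  have : IsFiniteMeasure (volume.restrict U) := isFiniteMeasure_restrict.2 hU
  have hint : Integrable (Function.uncurry fun (s : ℝ) (c : ℝ) => (Real.exp (-δ * s) : ℂ) *
      Complex.exp (-(Complex.I * ((x - c : ℝ) : ℂ) * s)))
      ((volume.restrict (Set.Ioi (0 : ℝ))).prod (volume.restrict U)) := by
    have h1 : Integrable (fun s : ℝ => (Real.exp (-δ * s) : ℂ)) (volume.restrict (Set.Ioi 0)) := by
      have : IntegrableOn (fun s : ℝ => Real.exp (-δ * s)) (Set.Ioi 0) :=
        exp_neg_integrableOn_Ioi 0 hδ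
      exact this.ofReal
    refine ((h1.mul_prod (integrable_const (1 : ℂ) (μ := volume.restrict U))).mul_bdd (c := 1)
      (g := fun q : ℝ × ℝ => Complex.exp (-(Complex.I * ((x - q.2 : ℝ) : ℂ) * q.1)))
      (by fun_prop) (Eventually.of_forall fun q => ?_)).congr (Eventually.of_forall fun q => ?_)
    · rw [norm_cexp_neg_I_mul]
    · simp [Function.uncurry]
  rw [halfLineTransform, cauchyIntegral]
  simp_rw [← integral_exp_mul_cexp hδ]
  rw [← integral_integral_swap hint]
  refine integral_congr_ae (Eventually.of_forall fun s => ?_)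
  simp only [cauchyDensity, mul_assoc, integral_const_mul, ← integral_mul_const]
  congr 1
  refine integral_congr_ae (Eventually.of_forall fun c => ?_)
  simp only [← Complex.exp_add]
  congr 1
  push_cast
  ring

theorem re_cauchyKernel (δ y : ℝ) :
    (((δ : ℂ) + Complex.I * y)⁻¹).re = δ / (δ ^ 2 + y ^ 2) := by
  rw [Complex.inv_re, Complex.normSq_apply]
  simp [sq]

theorem norm_cauchyKernel_le (δ : ℝ) {y : ℝ} (hy : y ≠ 0) :
    ‖((δ : ℂ) + Complex.I * y)⁻¹‖ ≤ |y|⁻¹ := by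
  rw [norm_inv]
  refine inv_anti₀ (abs_pos.2 hy) ?_
  simpa using Complex.abs_im_le_norm ((δ : ℂ) + Complex.I * y)

theorem integrableOn_cauchyKernel {δ : ℝ} (hδ : 0 < δ) {U : Set ℝ} (hU : volume U ≠ ⊤) (x : ℝ) :
    IntegrableOn (fun c : ℝ => ((δ : ℂ) + Complex.I * ((x - c : ℝ) : ℂ))⁻¹) U := by
  have : IsFiniteMeasure (volume.restrict U) := isFiniteMeasure_restrict.2 hU
  have hre : ∀ c : ℝ, ((δ : ℂ) + Complex.I * ((x - c : ℝ) : ℂ)).re = δ := fun c => by simp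
  refine Integrable.of_bound (C := δ⁻¹) ?_ (Eventually.of_forall fun c => ?_)
  · refine Continuous.aestronglyMeasurable (Continuous.inv₀ (by fun_prop) fun c h => ?_)
    have := hre c
    rw [h] at this
    exact hδ.ne this
  · rw [norm_inv]
    refine inv_anti₀ hδ ?_
    have := Complex.abs_re_le_norm ((δ : ℂ) + Complex.I * ((x - c : ℝ) : ℂ))
    rwa [hre, abs_of_pos hδ] at this

theorem re_cauchyIntegral {δ : ℝ} (hδ : 0 < δ) {U : Set ℝ} (hU : volume U ≠ ⊤) (x : ℝ) :
    (cauchyIntegral δ U x).re = ∫ c in U, δ / (δ ^ 2 + (x - c) ^ 2) := by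
  have := integral_re (integrableOn_cauchyKernel hδ hU x)
  rw [cauchyIntegral]
  simp only [RCLike.re_to_complex, re_cauchyKernel] at this
  exact this.symm

theorem re_cauchyIntegral_nonneg {δ : ℝ} (hδ : 0 < δ) {U : Set ℝ} (hU : volume U ≠ ⊤) (x : ℝ) :
    0 ≤ (cauchyIntegral δ U x).re := by
  rw [re_cauchyIntegral hδ hU]
  exact integral_nonneg fun c => by positivity

/-- The real part of the kernel, δ/(δ² + y²), is at least 1/(2δ) for |y| ≤ δ, an interval of length
2δ. -/
theorem one_le_re_cauchyIntegral {δ : ℝ} (hδ : 0 < δ) {U : Set ℝ} (hU : volume U ≠ ⊤) {x : ℝ}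
    (hx : Set.Icc (x - δ) (x + δ) ⊆ U) : 1 ≤ (cauchyIntegral δ U x).re := by
  rw [re_cauchyIntegral hδ hU]
  have hint : IntegrableOn (fun c : ℝ => δ / (δ ^ 2 + (x - c) ^ 2)) U := by
    refine (integrableOn_cauchyKernel hδ hU x).re.congr (Eventually.of_forall fun c => ?_)
    simp only [RCLike.re_to_complex, re_cauchyKernel]
  calc (1 : ℝ) = ∫ _ in Set.Icc (x - δ) (x + δ), 1 / (2 * δ) := by
        simp only [integral_const, MeasurableSet.univ, measureReal_restrict_apply, Set.univ_inter,
          Real.volume_real_Icc, smul_eq_mul]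
        rw [max_eq_left (by linarith)]
        field_simp
        ring
    _ ≤ ∫ c in Set.Icc (x - δ) (x + δ), δ / (δ ^ 2 + (x - c) ^ 2) := by
        refine setIntegral_mono_on (integrable_const _) (hint.mono_set hx) measurableSet_Icc
          fun c hc => ?_
        rw [div_le_div_iff₀ (by positivity) (by positivity)]
        have h1 : (x - c) ^ 2 ≤ δ ^ 2 := sq_le_sq' (by linarith [hc.2]) (by linarith [hc.1])
        nlinarith
    _ ≤ _ := setIntegral_mono_set hint (Eventually.of_forall fun c => by positivity)
        hx.eventuallyLE

theorem norm_cauchyIntegral_le {δ : ℝ} {U : Set ℝ} (hU : volume U ≠ ⊤) {x r : ℝ} (hr : 0 < r)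
    (h : ∀ c ∈ U, r ≤ |x - c|) : ‖cauchyIntegral δ U x‖ ≤ r⁻¹ * volume.real U := by
  refine norm_setIntegral_le_of_norm_le_const hU.lt_top fun c hc => ?_
  have h0 : 0 < |x - c| := hr.trans_le (h c hc)
  exact (norm_cauchyKernel_le δ (abs_pos.1 h0)).trans (inv_anti₀ hr (h c hc))

variable {ν : Measure ℝ} [IsFiniteMeasure ν] {h : ℝ → ℂ}

/-- A complex measure whose Fourier transform decays exponentially on a half-line does not charge
compact null sets. -/
theorem setIntegral_eq_zero_of_isCompact (hh : Integrable h ν)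
    (hT : IntegrableOn (fun s : ℝ => Real.exp (s / 2) *
      ‖∫ x, h x * Complex.exp (-(Complex.I * s * x)) ∂ν‖) (Set.Ioi 0)) {K : Set ℝ}
    (hK : IsCompact K) (hK0 : volume K = 0) : ∫ x in K, h x ∂ν = 0 := by
  rcases K.eq_empty_or_nonempty with rfl | hne
  · simp
  set C := ∫ s in Set.Ioi (0 : ℝ), Real.exp (s / 2) *
        ‖∫ x, h x * Complex.exp (-(Complex.I * s * x)) ∂ν‖ with hC
  let δ : ℕ → ℝ := fun n => 1 / ((n : ℝ) + 1)
  have hδ : ∀ n, 0 < δ n := fun n => by positivity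
  have hδ0 : Tendsto δ atTop (𝓝 0) := tendsto_one_div_add_atTop_nhds_zero_nat
  let U : ℕ → Set ℝ := fun n => Metric.cthickening (δ n) K
  have hU : ∀ n, volume (U n) ≠ ⊤ := fun n => hK.cthickening.measure_lt_top.ne
  have hσ : Tendsto (fun n => volume.real (U n)) atTop (𝓝 0) := by
    have h1 := (tendsto_measure_cthickening_of_isCompact (μ := volume) hK).comp hδ0
    rw [hK0] at h1
    exact (ENNReal.tendsto_toReal ENNReal.zero_ne_top).comp h1
  -- These have nonnegative real part, real part at least 1 on K, and tend to 0 off K. Their Laplace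
  -- densities are bounded by |U n|, which tends to |K| = 0.
  let G : ℕ → ℝ → ℂ := fun n => cauchyIntegral (δ n) (U n)
  have hG : ∀ n, halfLineTransform (cauchyDensity (δ n) (U n)) = G n := fun n =>
    funext fun x => halfLineTransform_cauchyDensity (hδ n) (hU n) x
  have hGc : ∀ n, Continuous (G n) := fun n => by
    rw [← hG]
    exact continuous_halfLineTransform (integrableOn_cauchyDensity (hδ n) (hU n))
  have hexp : ∀ (N : ℕ) n x, ‖Complex.exp (-(N * G n x))‖ ≤ 1 := fun N n x => by
    rw [Complex.norm_exp, Real.exp_le_one_iff]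
    have := re_cauchyIntegral_nonneg (hδ n) (hU n) x
    simp only [Complex.neg_re, Complex.mul_re, Complex.natCast_re, Complex.natCast_im, zero_mul,
      sub_zero]
    exact neg_nonpos.2 (mul_nonneg (Nat.cast_nonneg _) this)
  have hexpi : ∀ (N : ℕ) n, Integrable (fun x => h x * Complex.exp (-(N * G n x))) ν :=
    fun N n => hh.mul_bdd (c := 1) (by have := hGc n; fun_prop) (Eventually.of_forall (hexp N n))
  have hG0 : ∀ x ∉ K, Tendsto (fun n => G n x) atTop (𝓝 0) := fun x hx => by
    have hd : 0 < Metric.infDist x K := (hK.isClosed.notMem_iff_infDist_pos hne).1 hx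
    have h1 : Tendsto (fun n => (Metric.infDist x K / 2)⁻¹ * volume.real (U n)) atTop (𝓝 0) := by
      simpa using hσ.const_mul (Metric.infDist x K / 2)⁻¹
    refine squeeze_zero_norm' ?_ h1
    filter_upwards [hδ0.eventually (gt_mem_nhds (half_pos hd))] with n hn
    refine norm_cauchyIntegral_le (hU n) (half_pos hd) fun c hc => ?_
    have h2 : Metric.infDist c K ≤ δ n := by
      rw [Metric.infDist]
      exact ENNReal.toReal_le_of_le_ofReal (hδ n).le (Metric.mem_cthickening_iff.1 hc)
    have h3 := Metric.infDist_le_infDist_add_dist (s := K) (x := x) (y := c)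
    rw [Real.dist_eq] at h3
    linarith
  -- For fixed N and n → ∞, ∫ h e^{−N G_n} tends to ∫ h by the decay hypothesis, and its part off K
  -- tends to the integral of h off K. Hence the part on K tends to ∫_K h, although it is bounded by
  -- e^{−N} ∫ |h|. Then N → ∞.
  have key : ∀ N : ℕ, ‖∫ x in K, h x ∂ν‖ ≤ Real.exp (-N) * ∫ x, ‖h x‖ ∂ν := fun N => by
    have e1 : Tendsto (fun n => (∫ x, h x * Complex.exp (-(N * G n x)) ∂ν) - ∫ x, h x ∂ν) atTop
        (𝓝 0) := by
      have h1 : Tendsto (fun n => C * (N * volume.real (U n)) *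
          Real.exp (2 * (N * volume.real (U n)))) atTop
          (𝓝 (C * (N * 0) * Real.exp (2 * (N * 0)))) :=
        ((hσ.const_mul (N : ℝ)).const_mul C).mul
          ((Real.continuous_exp.tendsto _).comp ((hσ.const_mul (N : ℝ)).const_mul 2))
      rw [mul_zero, mul_zero, zero_mul] at h1
      refine squeeze_zero_norm (fun n => ?_) h1
      rw [← hG]
      refine norm_integral_mul_exp_sub_le hh (integrableOn_cauchyDensity (hδ n) (hU n))
        measureReal_nonneg (fun s hs => ?_) hT N
      refine (norm_cauchyDensity_le (hU n) s).trans ?_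
      refine mul_le_of_le_one_left measureReal_nonneg (Real.exp_le_one_iff.2 ?_)
      nlinarith [hδ n]
    have e2 : Tendsto (fun n => ∫ x in Kᶜ, h x * Complex.exp (-(N * G n x)) ∂ν) atTop
        (𝓝 (∫ x in Kᶜ, h x ∂ν)) := by
      refine tendsto_integral_of_dominated_convergence (fun x => ‖h x‖)
        (fun n => (hexpi N n).1.restrict) hh.norm.integrableOn
        (fun n => Eventually.of_forall fun x => ?_) ?_
      · rw [norm_mul]
        exact mul_le_of_le_one_right (norm_nonneg _) (hexp N n x)
      · refine (ae_restrict_iff' hK.measurableSet.compl).2 (Eventually.of_forall fun x hx => ?_)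
        have h1 : Tendsto (fun n => h x * Complex.exp (-(N * G n x))) atTop
            (𝓝 (h x * Complex.exp (-(N * 0)))) :=
          ((Complex.continuous_exp.tendsto _).comp ((hG0 x hx).const_mul (N : ℂ)).neg).const_mul _
        simpa using h1
    have e3 : Tendsto (fun n => ∫ x in K, h x * Complex.exp (-(N * G n x)) ∂ν) atTop
        (𝓝 (∫ x in K, h x ∂ν)) := by
      have h1 := (e1.add_const (∫ x, h x ∂ν)).sub e2
      rw [zero_add, ← integral_add_compl hK.measurableSet hh, add_sub_cancel_right] at h1
      refine h1.congr fun n => ?_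
      rw [integral_add_compl hK.measurableSet hh, sub_add_cancel,
        ← integral_add_compl hK.measurableSet (hexpi N n), add_sub_cancel_right]
    refine le_of_tendsto e3.norm (Eventually.of_forall fun n => ?_)
    calc ‖∫ x in K, h x * Complex.exp (-(N * G n x)) ∂ν‖
        ≤ ∫ x in K, Real.exp (-N) * ‖h x‖ ∂ν := by
          refine norm_integral_le_of_norm_le (hh.norm.const_mul _).integrableOn ?_
          refine (ae_restrict_iff' hK.measurableSet).2 (Eventually.of_forall fun x hx => ?_)
          rw [norm_mul, mul_comm]
          gcongr
          rw [Complex.norm_exp, Real.exp_le_exp]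
          have h1 : 1 ≤ (G n x).re := one_le_re_cauchyIntegral (hδ n) (hU n) (by
            rw [← Real.closedBall_eq_Icc]
            exact Metric.closedBall_subset_cthickening hx _)
          simp only [Complex.neg_re, Complex.mul_re, Complex.natCast_re, Complex.natCast_im,
            zero_mul, sub_zero, neg_le_neg_iff]
          exact le_mul_of_one_le_right (Nat.cast_nonneg _) h1
      _ ≤ ∫ x, Real.exp (-N) * ‖h x‖ ∂ν := by
          refine setIntegral_le_integral (hh.norm.const_mul _) (Eventually.of_forall fun x => ?_)
          positivity
      _ = _ := integral_const_mul _ _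
  have hlim : Tendsto (fun N : ℕ => Real.exp (-N) * ∫ x, ‖h x‖ ∂ν) atTop (𝓝 0) := by
    have h1 : Tendsto (fun N : ℕ => Real.exp (-(N : ℝ))) atTop (𝓝 0) :=
      Real.tendsto_exp_neg_atTop_nhds_zero.comp tendsto_natCast_atTop_atTop
    simpa using h1.mul_const (∫ x, ‖h x‖ ∂ν)
  exact norm_le_zero_iff.1 (ge_of_tendsto' hlim key)

/-- A complex measure whose Fourier transform decays exponentially on a half-line is absolutely
continuous. -/
theorem exists_L1_density (hhm : Measurable h) (hh : Integrable h ν)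
    (hT : IntegrableOn (fun s : ℝ => Real.exp (s / 2) *
      ‖∫ x, h x * Complex.exp (-(Complex.I * s * x)) ∂ν‖) (Set.Ioi 0)) :
    ∃ m : ℝ → ℂ, Integrable m ∧ ∫ x, ‖m x‖ ≤ ∫ x, ‖h x‖ ∂ν ∧
      ∀ g : ℝ → ℂ, ∫ x, g x * h x ∂ν = ∫ x, g x * m x := by
  set κ := ν.withDensity fun x => ‖h x‖ₑ with hκ
  have hκf : IsFiniteMeasure κ := isFiniteMeasure_withDensity hh.2.ne
  have hκint : ∀ f : ℝ → ℂ, ∫ x, f x ∂κ = ∫ x, (‖h x‖ : ℂ) * f x ∂ν := fun f => by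
    rw [hκ, integral_withDensity_eq_integral_toReal_smul hhm.enorm
      (Eventually.of_forall fun x => enorm_lt_top)]
    simp
  -- Inner regularity of the finite measure |h| ν passes from compact null sets to all measurable
  -- null sets.
  have hB : ∀ B, MeasurableSet B → volume B = 0 → ∫ x in B, h x ∂ν = 0 := fun B hB hB0 => by
    refine norm_le_zero_iff.1 (le_of_forall_pos_le_add fun ε hε => ?_)
    obtain ⟨K, hKB, hK, hlt⟩ := hB.exists_isCompact_sdiff_lt (μ := κ) (measure_ne_top _ _)
      (ENNReal.ofReal_pos.2 hε).ne'
    have hK0 := setIntegral_eq_zero_of_isCompact hh hT hK (measure_mono_null hKB hB0)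
    have h1 := setIntegral_union (f := h) (μ := ν) (Set.disjoint_sdiff_right (s := K) (t := B))
      (hB.diff hK.measurableSet) hh.integrableOn hh.integrableOn
    rw [Set.union_sdiff_cancel hKB, hK0, zero_add] at h1
    rw [h1, zero_add]
    refine (norm_integral_le_integral_norm _).trans ?_
    rw [integral_norm_eq_lintegral_enorm hh.1.restrict,
      ← withDensity_apply _ (hB.diff hK.measurableSet)]
    exact ENNReal.toReal_le_of_le_ofReal hε.le hlt.le
  have hac : κ ≪ volume := by
    refine Measure.AbsolutelyContinuous.mk fun E hE hE0 => ?_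
    have h1 : h =ᵐ[ν.restrict E] 0 := by
      refine Integrable.ae_eq_zero_of_forall_setIntegral_eq_zero hh.integrableOn fun s hs _ => ?_
      rw [Measure.restrict_restrict hs]
      exact hB _ (hs.inter hE) (measure_mono_null Set.inter_subset_right hE0)
    rw [hκ, withDensity_apply _ hE]
    rw [lintegral_congr_ae (g := fun _ => 0)]
    · simp
    · filter_upwards [h1] with x hx
      simp [hx]
  set ρ : ℝ → ℝ := fun x => (κ.rnDeriv volume x).toReal with hρ
  have hρi : Integrable ρ := Measure.integrable_toReal_rnDeriv
  have hρint : ∀ f : ℝ → ℂ, ∫ x, (ρ x : ℂ) * f x = ∫ x, f x ∂κ := fun f => by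
    rw [← integral_rnDeriv_smul hac]
    simp [hρ]
  -- Polar decomposition: the density sought is the Radon–Nikodym derivative of |h| ν times the
  -- phase of h, which is 0 where h vanishes.
  set S : ℝ → ℂ := fun x => h x / (‖h x‖ : ℂ) with hS
  have hSn : ∀ x, ‖S x‖ ≤ 1 := fun x => by
    simp only [hS, norm_div, Complex.norm_real, norm_norm]
    exact div_self_le_one _
  have hSm : Measurable S := hhm.div (Complex.measurable_ofReal.comp hhm.norm)
  have hSh : ∀ x, (‖h x‖ : ℂ) * S x = h x := fun x => by
    simp only [hS]
    rcases eq_or_ne (h x) 0 with h0 | h0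
    · simp [h0]
    · have : (‖h x‖ : ℂ) ≠ 0 := by simpa using h0
      field_simp
  have hmi : Integrable fun x => (ρ x : ℂ) * S x :=
    hρi.ofReal.mul_bdd hSm.aestronglyMeasurable (Eventually.of_forall hSn)
  refine ⟨fun x => (ρ x : ℂ) * S x, hmi, ?_, fun g => ?_⟩
  · have h1 : ∫ x, ρ x = ∫ x, ‖h x‖ ∂ν := by
      have := hρint fun _ => 1
      rw [hκint] at this
      simp only [mul_one, integral_complex_ofReal] at this
      exact_mod_cast this
    rw [← h1]
    refine integral_mono hmi.norm hρi fun x => ?_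
    simp only [norm_mul, Complex.norm_real]
    rw [Real.norm_of_nonneg (ENNReal.toReal_nonneg : 0 ≤ ρ x)]
    exact mul_le_of_le_one_right ENNReal.toReal_nonneg (hSn x)
  · calc ∫ x, g x * h x ∂ν = ∫ x, (‖h x‖ : ℂ) * (g x * S x) ∂ν := by
          refine integral_congr_ae (Eventually.of_forall fun x => ?_)
          simp only
          rw [mul_left_comm, hSh]
      _ = ∫ x, (ρ x : ℂ) * (g x * S x) := by rw [← hκint, hρint]
      _ = _ := by
          refine integral_congr_ae (Eventually.of_forall fun x => ?_)
          simp only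
          ring

end RieszBrothers

/-! ### The space of admissible pairs -/

theorem integrable_zeroAtInfty_mul_fourier (g : C₀(ℝ, ℂ)) {φ : ℝ → ℂ} (hφ : IsTestFunction φ) :
    Integrable fun x => g x * fourier φ x :=
  hφ.integrable_fourier.bdd_mul (c := ‖g‖) (continuous_zeroAtInfty g).aestronglyMeasurable
    (Eventually.of_forall fun x => norm_apply_le g x)

theorem LocallyIntegrable.integrable_mul_testFunction {u φ : ℝ → ℂ} (hu : LocallyIntegrable u)
    (hφ : IsTestFunction φ) : Integrable fun k => u k * φ k :=
  hu.integrable_smul_right_of_hasCompactSupport hφ.continuous hφ.2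

theorem IsDualAdmissible.congr_ae {γ : ℝ} {g : C₀(ℝ, ℂ)} {u v : ℝ → ℂ}
    (h : IsDualAdmissible γ g u) (huv : u =ᵐ[volume] v) : IsDualAdmissible γ g v := by
  refine ⟨⟨h.1.1.congr huv, fun φ hφ => ?_⟩, h.2.congr_ae huv⟩
  rw [← h.1.2 φ hφ]
  refine integral_congr_ae ?_
  filter_upwards [huv] with k hk
  rw [hk]

theorem IsDualAdmissible.add {γ : ℝ} {g g' : C₀(ℝ, ℂ)} {u u' : ℝ → ℂ}
    (h : IsDualAdmissible γ g u) (h' : IsDualAdmissible γ g' u') :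
    IsDualAdmissible γ (g + g') (u + u') := by
  refine ⟨⟨h.1.1.add h'.1.1, fun φ hφ => ?_⟩, MemLp.add h.2 h'.2⟩
  simp only [Pi.add_apply, ZeroAtInftyContinuousMap.add_apply, add_mul]
  rw [integral_add (LocallyIntegrable.integrable_mul_testFunction h.1.1 hφ)
    (LocallyIntegrable.integrable_mul_testFunction h'.1.1 hφ),
    integral_add (integrable_zeroAtInfty_mul_fourier g hφ)
    (integrable_zeroAtInfty_mul_fourier g' hφ), h.1.2 φ hφ, h'.1.2 φ hφ]

theorem IsDualAdmissible.smul {γ : ℝ} {g : C₀(ℝ, ℂ)} {u : ℝ → ℂ} (h : IsDualAdmissible γ g u)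
    (c : ℂ) : IsDualAdmissible γ (c • g) (c • u) := by
  refine ⟨⟨h.1.1.smul c, fun φ hφ => ?_⟩, MemLp.const_smul h.2 c⟩
  simp only [Pi.smul_apply, ZeroAtInftyContinuousMap.smul_apply, smul_eq_mul, mul_assoc,
    integral_const_mul]
  rw [h.1.2 φ hφ]

theorem IsDualAdmissible.zero (γ : ℝ) : IsDualAdmissible γ (0 : C₀(ℝ, ℂ)) 0 :=
  ⟨⟨locallyIntegrable_zero, fun φ _ => by simp⟩, MemLp.zero⟩

/-- The product of `C₀(ℝ)` and `L²_{-γ}(ℝ)`, with the maximum norm. -/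
abbrev DualSpace (γ : ℝ) : Type := C₀(ℝ, ℂ) × Lp ℂ 2 (expWeight (-γ))

/-- The subspace of all pairs `(g, ĝ)`. -/
def admissiblePairs (γ : ℝ) : Submodule ℂ (DualSpace γ) where
  carrier := {p | IsDualAdmissible γ p.1 p.2}
  add_mem' {p q} hp hq := by
    refine (IsDualAdmissible.add hp hq).congr_ae ?_
    exact (absolutelyContinuous_expWeight (-γ)).ae_eq (Lp.coeFn_add p.2 q.2).symm
  zero_mem' := by
    refine (IsDualAdmissible.zero γ).congr_ae ?_
    exact (absolutelyContinuous_expWeight (-γ)).ae_eq (Lp.coeFn_zero ℂ 2 _).symm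
  smul_mem' c p hp := by
    refine (IsDualAdmissible.smul hp c).congr_ae ?_
    exact (absolutelyContinuous_expWeight (-γ)).ae_eq (Lp.coeFn_smul c p.2).symm

theorem mem_admissiblePairs {γ : ℝ} {p : DualSpace γ} :
    p ∈ admissiblePairs γ ↔ IsDualAdmissible γ p.1 p.2 := Iff.rfl

theorem expPairing_congr_ae (m : ℝ → ℂ) (g : C₀(ℝ, ℂ)) {u v : ℝ → ℂ} (huv : u =ᵐ[volume] v) :
    expPairing m g u = expPairing m g v := by
  unfold expPairing
  congr 1
  refine integral_congr_ae ?_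
  filter_upwards [huv] with k hk
  rw [hk]

theorem memL2_coeFn {γ : ℝ} (U : Lp ℂ 2 (expWeight γ)) : MemL2 γ U := Lp.memLp U

theorem integrable_L1_mul_zeroAtInfty (m : L1) (g : C₀(ℝ, ℂ)) :
    Integrable fun y => (m : ℝ → ℂ) y * g (-y) :=
  (L1.integrable_coeFn m).mul_bdd (c := ‖g‖)
    ((continuous_zeroAtInfty g).comp continuous_neg).aestronglyMeasurable
    (Eventually.of_forall fun _ => norm_apply_le g _)

/-- The pairing with the exponential as a linear functional. -/
noncomputable def expPairingLinear {γ : ℝ} {m : L1} (hm : m ∈ primalDomain γ) :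
    DualSpace γ →ₗ[ℂ] ℂ where
  toFun p := expPairing m p.1 p.2
  map_add' p q := by
    rw [Prod.snd_add, expPairing_congr_ae m _
      ((absolutelyContinuous_expWeight (-γ)).ae_eq (Lp.coeFn_add p.2 q.2))]
    simp only [expPairing, Prod.fst_add, ZeroAtInftyContinuousMap.add_apply, Pi.add_apply, mul_add,
      add_mul]
    rw [integral_add (integrable_L1_mul_zeroAtInfty m p.1) (integrable_L1_mul_zeroAtInfty m q.1),
      integral_add ((memL2_coeFn p.2).integrable_mul hm) ((memL2_coeFn q.2).integrable_mul hm)]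
    ring
  map_smul' c p := by
    rw [Prod.smul_snd, expPairing_congr_ae m _
      ((absolutelyContinuous_expWeight (-γ)).ae_eq (Lp.coeFn_smul c p.2))]
    simp only [expPairing, Prod.smul_fst, ZeroAtInftyContinuousMap.smul_apply, Pi.smul_apply,
      smul_eq_mul, RingHom.id_apply, mul_assoc, mul_left_comm _ c, integral_const_mul]
    ring

/-! ### Bounds for the dual values -/

theorem dualValues_nonempty {γ : ℝ} (hγ : 2 < γ) : (dualValues γ).Nonempty := by
  obtain ⟨m, hm⟩ := primalDomain_nonempty hγ
  obtain ⟨φ, hφ, h0⟩ := exists_isTestFunction_eq_one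
  exact ⟨_, invFourier hφ, φ, _, invFourier_ne_zero hφ (by simp [h0]),
    isDualAdmissible_invFourier hφ γ,
    hasExpPairing_expPairing (isDualAdmissible_invFourier hφ γ) hm, rfl⟩

theorem le_of_mem_dualValues {γ : ℝ} (hγ : 2 < γ) {m : L1} (hm : m ∈ primalDomain γ) {r : ℝ}
    (hr : r ∈ dualValues γ) :
    r ≤ γ ^ γ / (4 * (γ - 2) ^ (γ - 2)) * (2 * Real.pi) ^ (γ - 2) * primalFunctional γ m := by
  obtain ⟨g, u, z, -, hu, hz, rfl⟩ := hr
  have hg : 0 < γ - 2 := by linarith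
  refine div_le_of_le_mul₀ (by positivity) ?_ (norm_rpow_expPairing_le hγ hu hz hm)
  have := primalFunctional_nonneg γ m
  positivity

theorem bddAbove_dualValues {γ : ℝ} (hγ : 2 < γ) : BddAbove (dualValues γ) := by
  obtain ⟨m, hm⟩ := primalDomain_nonempty hγ
  exact ⟨_, fun r hr => le_of_mem_dualValues hγ hm hr⟩

theorem sSup_dualValues_nonneg (γ : ℝ) : 0 ≤ sSup (dualValues γ) := by
  refine Real.sSup_nonneg ?_
  rintro _ ⟨g, u, z, -, -, -, rfl⟩
  positivity

/-- The product ‖g‖^{γ−2} ‖ĝ‖² is at most the γ-th power of the maximum norm. If the product is 0,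
the quotient in `dualValues` carries no information, and weak duality gives z = 0 instead. -/
theorem norm_expPairing_le_sSup {γ : ℝ} (hγ : 2 < γ) {m : L1} (hm : m ∈ primalDomain γ)
    {p : DualSpace γ} (hp : p ∈ admissiblePairs γ) :
    ‖expPairing m p.1 p.2‖ ≤ sSup (dualValues γ) ^ γ⁻¹ * ‖p‖ := by
  have hγ0 : 0 < γ := by linarith
  have hz := hasExpPairing_expPairing (mem_admissiblePairs.1 hp) hm
  set z := expPairing m p.1 p.2 with hzdef
  set D := sSup (dualValues γ) with hD
  have hD0 : 0 ≤ D := sSup_dualValues_nonneg γ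
  have hn : normL2 (-γ) p.2 = ‖p.2‖ := (Lp.norm_def p.2).symm
  have key : ‖z‖ ^ γ ≤ D * ‖p‖ ^ γ := by
    have hw := norm_rpow_expPairing_le hγ (mem_admissiblePairs.1 hp) hz hm
    rcases eq_or_ne (‖p.1‖ ^ (γ - 2) * normL2 (-γ) p.2 ^ 2) 0 with h0 | h0
    · rw [h0, mul_zero] at hw
      exact hw.trans (by positivity)
    · have hg : p.1 ≠ 0 := by
        rintro h
        rw [h, norm_zero, Real.zero_rpow (by linarith), zero_mul] at h0
        exact h0 rfl
      have h1 : ‖z‖ ^ γ / (‖p.1‖ ^ (γ - 2) * normL2 (-γ) p.2 ^ 2) ≤ D :=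
        le_csSup (bddAbove_dualValues hγ) ⟨p.1, p.2, z, hg, hp, hz, rfl⟩
      rw [div_le_iff₀ (lt_of_le_of_ne (by positivity) h0.symm)] at h1
      refine h1.trans ?_
      have hp0 : 0 < ‖p‖ := (norm_pos_iff.2 hg).trans_le (norm_fst_le p)
      calc D * (‖p.1‖ ^ (γ - 2) * normL2 (-γ) p.2 ^ 2)
          ≤ D * (‖p‖ ^ (γ - 2) * ‖p‖ ^ 2) := by
            rw [hn]
            gcongr
            · exact norm_fst_le p
            · exact norm_snd_le p
        _ = D * ‖p‖ ^ γ := by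
            rw [← Real.rpow_natCast ‖p‖ 2, ← Real.rpow_add hp0]
            congr 2
            push_cast
            ring
  have h2 := Real.rpow_le_rpow (by positivity) key (inv_nonneg.2 hγ0.le)
  rwa [Real.mul_rpow hD0 (by positivity), ← Real.rpow_mul (norm_nonneg _),
    ← Real.rpow_mul (norm_nonneg _), mul_inv_cancel₀ hγ0.ne', Real.rpow_one, Real.rpow_one] at h2

/-- The weighted inequality of arithmetic and geometric means. -/
theorem rpow_mul_sq_le {γ a b : ℝ} (hγ : 2 < γ) (ha : 0 ≤ a) (hb : 0 ≤ b) :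
    a ^ (γ - 2) * b ^ 2 ≤ 4 * (γ - 2) ^ (γ - 2) / γ ^ γ * (a + b) ^ γ := by
  have hγ0 : 0 < γ := by linarith
  have hg : 0 < γ - 2 := by linarith
  -- The weights are the exponents γ − 2 and 2 divided by γ; the points are rescaled so that their
  -- weighted mean is a + b.
  have h := Real.geom_mean_le_arith_mean2_weighted (w₁ := (γ - 2) / γ) (w₂ := 2 / γ)
    (p₁ := a * (γ / (γ - 2))) (p₂ := b * (γ / 2)) (by positivity) (by positivity) (by positivity)
    (by positivity) (by field_simp; ring)
  have h1 : (γ - 2) / γ * (a * (γ / (γ - 2))) + 2 / γ * (b * (γ / 2)) = a + b := by field_simp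
  rw [h1] at h
  have h2 := Real.rpow_le_rpow (by positivity) h hγ0.le
  rw [Real.mul_rpow (by positivity) (by positivity), ← Real.rpow_mul (by positivity),
    ← Real.rpow_mul (by positivity), div_mul_cancel₀ _ hγ0.ne', div_mul_cancel₀ _ hγ0.ne',
    Real.mul_rpow ha (by positivity), Real.div_rpow hγ0.le hg.le, Real.rpow_two, mul_pow] at h2
  have e3 : γ ^ γ = γ ^ (γ - 2) * γ ^ 2 := by
    rw [← Real.rpow_natCast γ 2, ← Real.rpow_add hγ0]; congr 1; push_cast; ring
  rw [div_mul_eq_mul_div, le_div_iff₀ (by positivity), e3]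
  have h3 : a ^ (γ - 2) * b ^ 2 * (γ ^ (γ - 2) * γ ^ 2) = 4 * (γ - 2) ^ (γ - 2) *
      (a ^ (γ - 2) * (γ ^ (γ - 2) / (γ - 2) ^ (γ - 2)) * (b ^ 2 * (γ / 2) ^ 2)) := by
    field_simp
    ring
  rw [h3]
  gcongr

/-- The dual norm of the maximum norm on a product is the sum of the dual norms. -/
theorem norm_comp_inl_add_norm_comp_inr_le {E F : Type*} [NormedAddCommGroup E] [NormedSpace ℂ E]
    [NormedAddCommGroup F] [NormedSpace ℂ F] (f : E × F →L[ℂ] ℂ) :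
    ‖f.comp (ContinuousLinearMap.inl ℂ E F)‖ + ‖f.comp (ContinuousLinearMap.inr ℂ E F)‖ ≤ ‖f‖ := by
  set ℓ := f.comp (ContinuousLinearMap.inl ℂ E F) with hℓ
  set W := f.comp (ContinuousLinearMap.inr ℂ E F) with hW
  -- Rescale x and y to the common norm ‖x‖ ‖y‖, which is then the maximum norm of the pair, and
  -- rotate both so that their values under f are nonnegative and add up.
  have key : ∀ x y, ‖ℓ x‖ * ‖y‖ + ‖W y‖ * ‖x‖ ≤ ‖f‖ * (‖x‖ * ‖y‖) := fun x y => by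
    obtain ⟨c, hc, hcx⟩ := exists_norm_eq_one_mul_eq_norm (ℓ x)
    obtain ⟨d, hd, hdy⟩ := exists_norm_eq_one_mul_eq_norm (W y)
    have hc' : ‖c‖ = 1 := congrArg NNReal.toReal hc
    have hd' : ‖d‖ = 1 := congrArg NNReal.toReal hd
    have h1 := f.le_opNorm (((‖y‖ : ℂ) * c) • x, ((‖x‖ : ℂ) * d) • y)
    have h2 : f (((‖y‖ : ℂ) * c) • x, ((‖x‖ : ℂ) * d) • y) =
        ((‖ℓ x‖ * ‖y‖ + ‖W y‖ * ‖x‖ : ℝ) : ℂ) := by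
      have : (((‖y‖ : ℂ) * c) • x, ((‖x‖ : ℂ) * d) • y) =
          ((‖y‖ : ℂ) * c) • ContinuousLinearMap.inl ℂ E F x +
          ((‖x‖ : ℂ) * d) • ContinuousLinearMap.inr ℂ E F y := by simp
      rw [this, map_add, map_smul, map_smul]
      change ((‖y‖ : ℂ) * c) * ℓ x + ((‖x‖ : ℂ) * d) * W y = _
      push_cast
      rw [← hcx, ← hdy]
      ring
    rw [h2, Complex.norm_real, Real.norm_of_nonneg (by positivity), Prod.norm_def] at h1
    simp only [norm_smul, norm_mul, hc', hd', Complex.norm_real, norm_norm, mul_one] at h1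
    rwa [mul_comm ‖y‖ ‖x‖, max_self] at h1
  have h1 : ∀ y, ‖W y‖ ≤ (‖f‖ - ‖ℓ‖) * ‖y‖ := fun y => by
    rcases eq_or_ne y 0 with rfl | hy
    · simp
    have hy0 : 0 < ‖y‖ := norm_pos_iff.2 hy
    have h2 : ‖ℓ‖ ≤ ‖f‖ - ‖W y‖ / ‖y‖ := by
      refine ℓ.opNorm_le_bound ?_ fun x => ?_
      · rw [sub_nonneg, div_le_iff₀ hy0]
        refine (f.le_opNorm (0, y)).trans_eq ?_
        simp
      · have h3 := key x y
        have h4 : ‖ℓ x‖ * ‖y‖ ≤ (‖f‖ - ‖W y‖ / ‖y‖) * ‖x‖ * ‖y‖ := by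
          have : (‖f‖ - ‖W y‖ / ‖y‖) * ‖x‖ * ‖y‖ = ‖f‖ * (‖x‖ * ‖y‖) - ‖W y‖ * ‖x‖ := by
            field_simp
          linarith
        exact le_of_mul_le_mul_right h4 hy0
    rw [le_sub_comm, div_le_iff₀ hy0] at h2
    exact h2
  have h0 : ‖ℓ‖ ≤ ‖f‖ := by
    refine ℓ.opNorm_le_bound (norm_nonneg _) fun x => ?_
    refine (f.le_opNorm (x, 0)).trans_eq ?_
    simp
  have := W.opNorm_le_bound (sub_nonneg.2 h0) h1
  linarith

/-! ### Attainment and strong duality -/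

theorem integral_expWeight (γ : ℝ) (f : ℝ → ℂ) :
    ∫ k, f k ∂expWeight γ = ∫ k, (Real.exp (-γ * k) : ℂ) * f k := by
  rw [expWeight, integral_withDensity_eq_integral_toReal_smul (by fun_prop)
    (Eventually.of_forall fun _ => ENNReal.ofReal_lt_top)]
  refine integral_congr_ae (Eventually.of_forall fun k => ?_)
  simp only [ENNReal.toReal_ofReal (Real.exp_pos _).le, Complex.real_smul]

theorem IsTestFunction.memLp {φ : ℝ → ℂ} (hφ : IsTestFunction φ) (γ : ℝ) :
    MemLp φ 2 (expWeight γ) := hφ.memL2 γ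

/-- The Riesz representation of functionals on `L²_{-γ}` by elements of `L²_γ`. -/
theorem exists_memL2_repr {γ : ℝ} (W : Lp ℂ 2 (expWeight (-γ)) →L[ℂ] ℂ) :
    ∃ w : ℝ → ℂ, MemL2 γ w ∧ normL2 γ w = ‖W‖ ∧
      ∀ (u : ℝ → ℂ) (hu : MemLp u 2 (expWeight (-γ))), W (hu.toLp u) = ∫ k, u k * w k := by
  set v := (InnerProductSpace.toDual ℂ _).symm W with hv
  have hvn : ‖v‖ = ‖W‖ := by simp [hv]
  have hvm : MemL2 (-γ) v := memL2_coeFn v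
  -- The inner product of L²_{−γ} contains the weight e^{γk} and a conjugation; absorbing both into
  -- w leaves the unweighted bilinear pairing.
  set w : ℝ → ℂ := fun k => (Real.exp (γ * k) : ℂ) * starRingEnd ℂ (v k) with hw
  have hwmeas : AEStronglyMeasurable w volume :=
    (by fun_prop : Continuous fun k : ℝ => (Real.exp (γ * k) : ℂ)).aestronglyMeasurable.mul
      (Complex.continuous_conj.comp_aestronglyMeasurable hvm.aestronglyMeasurable)
  have hnorm : eLpNorm w 2 (expWeight γ) = eLpNorm v 2 (expWeight (-γ)) := by
    rw [eLpNorm_expWeight, eLpNorm_expWeight]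
    refine eLpNorm_congr_norm_ae (Eventually.of_forall fun k => ?_)
    simp only [hw, norm_mul, Complex.norm_real, RCLike.norm_conj, Real.norm_eq_abs, Real.abs_exp]
    rw [← mul_assoc, ← Real.exp_add]
    congr 2
    ring
  refine ⟨w, ⟨aestronglyMeasurable_expWeight_iff.2 hwmeas, hnorm.trans_lt hvm.2⟩, ?_,
    fun u hu => ?_⟩
  · rw [normL2, hnorm, ← hvn, Lp.norm_def]
  · have h1 : W (hu.toLp u) = inner ℂ v (hu.toLp u) := by
      rw [hv, InnerProductSpace.toDual_symm_apply]
    rw [h1, L2.inner_def]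
    have h2 : ∫ k, inner ℂ (v k) (hu.toLp u k) ∂expWeight (-γ) =
        ∫ k, u k * starRingEnd ℂ (v k) ∂expWeight (-γ) := by
      refine integral_congr_ae ?_
      filter_upwards [hu.coeFn_toLp] with k hk
      rw [hk, RCLike.inner_apply]
    rw [h2, integral_expWeight]
    refine integral_congr_ae (Eventually.of_forall fun k => ?_)
    simp only [hw, neg_neg]
    ring

theorem IsTestFunction.comp_neg {φ : ℝ → ℂ} (hφ : IsTestFunction φ) :
    IsTestFunction fun k => φ (-k) :=
  ⟨hφ.1.comp contDiff_neg, hφ.2.comp_homeomorph (Homeomorph.neg ℝ)⟩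

theorem fourier_comp_neg (f : ℝ → ℂ) (k : ℝ) : fourier (fun x => f (-x)) k = fourier f (-k) := by
  rw [fourier, fourier, ← integral_neg_eq_self]
  refine integral_congr_ae (Eventually.of_forall fun x => ?_)
  simp

theorem ae_eq_of_integral_testFunction {a b : ℝ → ℂ} (ha : LocallyIntegrable a)
    (hb : LocallyIntegrable b)
    (h : ∀ φ, IsTestFunction φ → ∫ k, a k * φ k = ∫ k, b k * φ k) : a =ᵐ[volume] b := by
  have h0 := ae_eq_zero_of_integral_contDiff_smul_eq_zero (ha.sub hb) fun g hg hg' => by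
    have hφ : IsTestFunction fun x => (g x : ℂ) :=
      ⟨Complex.ofRealCLM.contDiff.comp hg, hg'.comp_left (g := fun x : ℝ => (x : ℂ)) (by simp)⟩
    have h1 := h _ hφ
    rw [← sub_eq_zero, ← integral_sub (LocallyIntegrable.integrable_mul_testFunction ha hφ)
      (LocallyIntegrable.integrable_mul_testFunction hb hφ)] at h1
    rw [← h1]
    refine integral_congr_ae (Eventually.of_forall fun k => ?_)
    simp only [Pi.sub_apply, Complex.real_smul]
    ring
  filter_upwards [h0] with k hk
  exact sub_eq_zero.1 hk

/-- Paired with w in L²_γ, this shows that e^{−k/2} w is integrable on the negative half-line. The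
rate 1/2 is admissible because it lies below γ/2 and also below 1, the rate at which exp itself
decays there. -/
theorem memL2_indicator_exp {γ : ℝ} (hγ : 2 < γ) :
    MemL2 (-γ) ((Set.Iio (0 : ℝ)).indicator fun k => (Real.exp (-k / 2) : ℂ)) := by
  rw [memL2_iff]
  have hm : AEStronglyMeasurable (fun k => (Real.exp (-(-γ) * k / 2) : ℂ) *
      (Set.Iio (0 : ℝ)).indicator (fun k => (Real.exp (-k / 2) : ℂ)) k) volume :=
    (by fun_prop : Continuous fun k : ℝ =>
      (Real.exp (-(-γ) * k / 2) : ℂ)).aestronglyMeasurable.mul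
      ((by fun_prop : Continuous fun k : ℝ =>
        (Real.exp (-k / 2) : ℂ)).aestronglyMeasurable.indicator measurableSet_Iio)
  rw [memLp_two_iff_integrable_sq_norm hm]
  have h1 : IntegrableOn (fun k => Real.exp ((γ - 1) * k)) (Set.Iio (0 : ℝ)) :=
    (integrableOn_exp_mul_Iic (by linarith) 0).mono_set Set.Iio_subset_Iic_self
  refine (h1.integrable_indicator measurableSet_Iio).congr (Eventually.of_forall fun k => ?_)
  by_cases hk : k ∈ Set.Iio (0 : ℝ)
  · simp only [Set.indicator_of_mem hk, norm_mul, Complex.norm_real, Real.norm_eq_abs,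
      Real.abs_exp]
    rw [← Real.exp_add, ← Real.exp_nat_mul]
    congr 1
    push_cast
    ring
  · simp [Set.indicator_of_notMem hk]

/-- If the Fourier transform of a complex measure differs from `exp` by a function in `L²_γ`,
then it decays exponentially on the negative half-line. -/
theorem integrableOn_exp_half_mul_norm {γ : ℝ} (hγ : 2 < γ) {w T : ℝ → ℂ} (hw : MemL2 γ w)
    (hT : (fun k => T (-k)) =ᵐ[volume] fun k => 2 * Real.pi * (expFun k - w k)) :
    IntegrableOn (fun s => Real.exp (s / 2) * ‖T s‖) (Set.Ioi 0) := by
  have h1 := ((memL2_indicator_exp hγ).integrable_mul hw).norm.comp_neg.integrableOn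
    (s := Set.Ioi 0)
  have h2 : T =ᵐ[volume] fun s => 2 * Real.pi * (expFun (-s) - w (-s)) := by
    have := (Measure.measurePreserving_neg (volume : Measure ℝ)).quasiMeasurePreserving.ae_eq_comp hT
    filter_upwards [this] with s hs
    simpa using hs
  have h3 : IntegrableOn (fun s => Real.exp (s / 2) *
      ‖2 * (Real.pi : ℂ) * (expFun (-s) - w (-s))‖) (Set.Ioi 0) := by
    refine ((integrableOn_exp_neg_half.add h1).const_mul (2 * Real.pi)).mono' ?_ ?_
    · refine AEStronglyMeasurable.restrict ?_
      refine (by fun_prop : Continuous fun s : ℝ => Real.exp (s / 2)).aestronglyMeasurable.mul ?_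
      refine AEStronglyMeasurable.norm (AEStronglyMeasurable.const_mul (AEStronglyMeasurable.sub ?_
        ?_) _)
      · unfold expFun
        exact (by fun_prop : Continuous fun s : ℝ => (Real.exp (-s) : ℂ)).aestronglyMeasurable
      · exact hw.aestronglyMeasurable.comp_measurePreserving (Measure.measurePreserving_neg _)
    · refine (ae_restrict_iff' measurableSet_Ioi).2 (Eventually.of_forall fun s hs => ?_)
      have hs : 0 < s := hs
      have hs' : -s ∈ Set.Iio (0 : ℝ) := by simpa using hs
      rw [Real.norm_of_nonneg (by positivity)]
      simp only [Pi.add_apply, Set.indicator_of_mem hs', norm_mul, Complex.norm_real,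
        Complex.norm_ofNat, Real.norm_eq_abs, Real.abs_exp, abs_of_pos Real.pi_pos, neg_neg]
      have h4 : ‖expFun (-s) - w (-s)‖ ≤ Real.exp (-s) + ‖w (-s)‖ := by
        refine (norm_sub_le _ _).trans_eq ?_
        rw [expFun, Complex.norm_real, Real.norm_eq_abs, Real.abs_exp]
      have h5 : Real.exp (-s / 2) = Real.exp (s / 2) * Real.exp (-s) := by
        rw [← Real.exp_add]
        congr 1
        ring
      rw [h5]
      calc _ ≤ Real.exp (s / 2) * (2 * Real.pi * (Real.exp (-s) + ‖w (-s)‖)) := by gcongr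
        _ = _ := by ring
  refine IntegrableOn.congr_fun_ae h3 (ae_restrict_of_ae ?_)
  filter_upwards [h2] with s hs
  rw [hs]

/-- From a representation of the pairing on test functions one obtains an element of the effective
domain. -/
theorem exists_mem_primalDomain {γ : ℝ} (hγ : 2 < γ) (ℓ : C₀(ℝ, ℂ) →L[ℂ] ℂ)
    (W : Lp ℂ 2 (expWeight (-γ)) →L[ℂ] ℂ)
    (h : ∀ (φ : ℝ → ℂ) (hφ : IsTestFunction φ),
      ℓ (invFourier hφ) + W ((hφ.memLp (-γ)).toLp φ) = ∫ k, φ k * expFun k) :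
    ∃ m ∈ primalDomain γ, ‖m‖ ≤ (2 * Real.pi)⁻¹ * ‖ℓ‖ ∧
      normL2 γ (fun k => fourier m k - expFun k) = ‖W‖ := by
  have hpi : (Real.pi : ℂ) ≠ 0 := by exact_mod_cast Real.pi_ne_zero
  obtain ⟨w, hw, hwn, hwW⟩ := exists_memL2_repr W
  obtain ⟨ν, η, hν, hηm, hηi, hηℓ, hηn⟩ := exists_measure_density ℓ
  set T : ℝ → ℂ := fun s => ∫ x, η x * Complex.exp (-(Complex.I * s * x)) ∂ν with hT
  have hTc : Continuous T := continuous_integral_mul_cexp hηi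
  have hexpc : Continuous expFun := by
    unfold expFun
    fun_prop
  -- On inverse transforms of test functions, ℓ acts through the Fourier transform of its measure;
  -- the reflection and the factor (2π)⁻¹ come from `invFourier`.
  have hℓφ : ∀ (φ : ℝ → ℂ) (hφ : IsTestFunction φ),
      ℓ (invFourier hφ) = ∫ k, (2 * Real.pi : ℂ)⁻¹ * T (-k) * φ k := fun φ hφ => by
    have h1 := integral_integral_mul_cexp_mul hηi hφ.comp_neg.integrable
    simp only [fourier_comp_neg] at h1
    calc ℓ (invFourier hφ) = (2 * Real.pi : ℂ)⁻¹ * ∫ x, η x * fourier φ (-x) ∂ν := by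
          rw [hηℓ, ← integral_const_mul]
          refine integral_congr_ae (Eventually.of_forall fun x => ?_)
          simp only [invFourier_apply]
          ring
      _ = (2 * Real.pi : ℂ)⁻¹ * ∫ k, T (-k) * φ k := by
          rw [← h1, ← integral_neg_eq_self]
          simp [hT]
      _ = _ := by simp_rw [mul_assoc, integral_const_mul]
  have hTw : (fun k => (2 * Real.pi : ℂ)⁻¹ * T (-k)) =ᵐ[volume] fun k => expFun k - w k := by
    refine ae_eq_of_integral_testFunction ?_ (hexpc.locallyIntegrable.sub hw.locallyIntegrable)
      fun φ hφ => ?_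
    · exact (continuous_const.mul (hTc.comp continuous_neg)).locallyIntegrable
    · rw [← hℓφ φ hφ, eq_sub_of_add_eq (h φ hφ), hwW, ← integral_sub]
      · refine integral_congr_ae (Eventually.of_forall fun k => ?_)
        simp only
        ring
      · exact (LocallyIntegrable.integrable_mul_testFunction hexpc.locallyIntegrable hφ).congr
          (Eventually.of_forall fun k => mul_comm _ _)
      · exact (hφ.memL2 (-γ)).integrable_mul hw
  have hTw' : (fun k => T (-k)) =ᵐ[volume] fun k => 2 * Real.pi * (expFun k - w k) := by
    filter_upwards [hTw] with k hk
    rw [← hk]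
    field_simp
  -- Both exp and w are small at −∞, so T decays at +∞ and the measure has a density.
  obtain ⟨m, hmi, hmn, hmη⟩ := exists_L1_density hηm hηi (integrableOn_exp_half_mul_norm hγ hw hTw')
  have hTm : ∀ s, T s = fourier m s := fun s => by
    have := hmη fun x => Complex.exp (-(Complex.I * s * x))
    simp_rw [mul_comm (Complex.exp _)] at this
    exact this
  have hmi' : Integrable fun x => (2 * Real.pi : ℂ)⁻¹ * m (-x) := hmi.comp_neg.const_mul _
  set M : L1 := hmi'.toL1 _ with hM
  have hMf : ∀ k, fourier M k = (2 * Real.pi : ℂ)⁻¹ * T (-k) := fun k => by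
    rw [fourier_congr_ae hmi'.coeFn_toL1, hTm, ← fourier_comp_neg, fourier, fourier,
      ← integral_const_mul]
    simp_rw [mul_assoc]
  have hMw : (fun k => fourier M k - expFun k) =ᵐ[volume] -w := by
    filter_upwards [hTw] with k hk
    rw [hMf, hk, Pi.neg_apply]
    ring
  refine ⟨M, MemL2.congr_ae (MemLp.neg hw) hMw.symm, ?_, ?_⟩
  · have h1 : ‖M‖ = (2 * Real.pi)⁻¹ * ∫ x, ‖m x‖ := by
      rw [norm_L1_eq, ← integral_neg_eq_self (fun x => ‖m x‖), ← integral_const_mul]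
      refine integral_congr_ae ?_
      filter_upwards [hmi'.coeFn_toL1] with x hx
      rw [hx, norm_mul, norm_inv, norm_mul, Complex.norm_real, Complex.norm_ofNat,
        Real.norm_of_nonneg Real.pi_pos.le]
    rw [h1]
    gcongr
    exact hmn.trans hηn
  · rw [normL2_congr_ae hMw, ← hwn, normL2, normL2, eLpNorm_neg]

/-- The constant in the duality formula. -/
noncomputable def dualityConst (γ : ℝ) : ℝ :=
  4 * (γ - 2) ^ (γ - 2) / ((2 * Real.pi) ^ (γ - 2) * γ ^ γ)

/-- Strong duality with attainment: the components of a norm-preserving extension already are a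
minimizer, so no minimizing sequence or compactness is needed. -/
theorem exists_primalFunctional_le {γ : ℝ} (hγ : 2 < γ) :
    ∃ m ∈ primalDomain γ, primalFunctional γ m ≤ dualityConst γ * sSup (dualValues γ) := by
  have hγ0 : 0 < γ := by linarith
  have hg : 0 < γ - 2 := by linarith
  obtain ⟨m₀, hm₀⟩ := primalDomain_nonempty hγ
  set D := sSup (dualValues γ) with hD
  have hD0 : 0 ≤ D := sSup_dualValues_nonneg γ
  -- The auxiliary `m₀` serves only to write ⟨exp, ĝ⟩ as a linear functional; on admissible pairs
  -- the value does not depend on it.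
  let L : admissiblePairs γ →ₗ[ℂ] ℂ := (expPairingLinear hm₀).comp (admissiblePairs γ).subtype
  obtain ⟨F, hF, hFn⟩ := exists_extension_norm_eq (admissiblePairs γ)
    (L.mkContinuous (D ^ γ⁻¹) fun p => norm_expPairing_le_sSup hγ hm₀ p.2)
  have hFD : ‖F‖ ≤ D ^ γ⁻¹ :=
    hFn.trans_le (LinearMap.mkContinuous_norm_le _ (by positivity) _)
  set ℓ := F.comp (ContinuousLinearMap.inl ℂ _ _) with hℓ
  set W := F.comp (ContinuousLinearMap.inr ℂ _ _) with hW
  have hsum : ‖ℓ‖ + ‖W‖ ≤ D ^ γ⁻¹ := (norm_comp_inl_add_norm_comp_inr_le F).trans hFD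
  obtain ⟨m, hm, hmn, hmW⟩ := exists_mem_primalDomain hγ ℓ W fun φ hφ => by
    have hφL := (hφ.memLp (-γ)).coeFn_toLp
    have hae : φ =ᵐ[volume] ((hφ.memLp (-γ)).toLp φ : ℝ → ℂ) :=
      (absolutelyContinuous_expWeight (-γ)).ae_eq hφL.symm
    have hp : ((invFourier hφ, (hφ.memLp (-γ)).toLp φ) :
        DualSpace γ) ∈ admissiblePairs γ :=
      (isDualAdmissible_invFourier hφ γ).congr_ae hae
    have h1 := hF ⟨_, hp⟩
    rw [← expPairing_invFourier hφ hm₀, expPairing_congr_ae _ _ hae]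
    refine Eq.trans ?_ h1
    change F _ + F _ = F _
    rw [← map_add]
    simp
  refine ⟨m, hm, ?_⟩
  rw [primalFunctional, hmW]
  calc ‖m‖ ^ (γ - 2) * ‖W‖ ^ 2
      ≤ ((2 * Real.pi)⁻¹ * ‖ℓ‖) ^ (γ - 2) * ‖W‖ ^ 2 := by gcongr
    _ = ((2 * Real.pi) ^ (γ - 2))⁻¹ * (‖ℓ‖ ^ (γ - 2) * ‖W‖ ^ 2) := by
        rw [Real.mul_rpow (by positivity) (norm_nonneg _), Real.inv_rpow (by positivity)]
        ring
    _ ≤ ((2 * Real.pi) ^ (γ - 2))⁻¹ *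
        (4 * (γ - 2) ^ (γ - 2) / γ ^ γ * (D ^ γ⁻¹) ^ γ) := by
        refine mul_le_mul_of_nonneg_left ?_ (by positivity)
        refine (rpow_mul_sq_le hγ (norm_nonneg ℓ) (norm_nonneg W)).trans ?_
        gcongr
    _ = dualityConst γ * D := by
        rw [← Real.rpow_mul hD0, inv_mul_cancel₀ hγ0.ne', Real.rpow_one, dualityConst]
        field_simp

theorem dualityConst_mul_sSup_le {γ : ℝ} (hγ : 2 < γ) {m : L1} (hm : m ∈ primalDomain γ) :
    dualityConst γ * sSup (dualValues γ) ≤ primalFunctional γ m := by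
  have hγ0 : 0 < γ := by linarith
  have hg : 0 < γ - 2 := by linarith
  have h1 := csSup_le (dualValues_nonempty hγ) fun r hr => le_of_mem_dualValues hγ hm hr
  have h2 : dualityConst γ * (γ ^ γ / (4 * (γ - 2) ^ (γ - 2)) * (2 * Real.pi) ^ (γ - 2) *
      primalFunctional γ m) = primalFunctional γ m := by
    rw [dualityConst]
    field_simp
  rw [← h2]
  refine mul_le_mul_of_nonneg_left h1 ?_
  unfold dualityConst
  positivity

/-- The primal infimum is attained and equals the dual supremum. -/
theorem exists_isPrimalMinimizer {γ : ℝ} (hγ : 2 < γ) :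
    (∃ m, IsPrimalMinimizer γ m) ∧ primalInf γ = dualityConst γ * sSup (dualValues γ) := by
  obtain ⟨m, hm, hle⟩ := exists_primalFunctional_le hγ
  have h1 : dualityConst γ * sSup (dualValues γ) ≤ primalInf γ := by
    refine le_csInf ⟨_, m, hm, rfl⟩ ?_
    rintro _ ⟨m', hm', rfl⟩
    exact dualityConst_mul_sSup_le hγ hm'
  have h2 := primalInf_le hm
  exact ⟨⟨m, hm, le_antisymm (hle.trans h1) h2⟩, le_antisymm (h2.trans hle) h1⟩

end PrimalOptimizer

open PrimalOptimizer
theorem theoremC1 (γ : ℝ) (hγ : 2 < γ) :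
    -- the infimum is a minimum
    IsLeast (primalFunctional γ '' primalDomain γ) (primalInf γ) ∧
    -- the minimizers form exactly one orbit of the scaling transformation
    (∃ m : L1, IsPrimalMinimizer γ m) ∧
    (∀ m : L1, IsPrimalMinimizer γ m → ∀ m' : L1,
      (IsPrimalMinimizer γ m' ↔
        ∃ α : ℝ, 0 < α ∧
          m' =ᵐ[volume] fun x : ℝ => m x * (α : ℂ) ^ (-(Complex.I * (x : ℂ)) - 1))) ∧
    -- the pairing of the exponential with the Fourier transform of `g` is well defined
    (∀ (g : C₀(ℝ, ℂ)) (u : ℝ → ℂ), IsDualAdmissible γ g u → ∃! z : ℂ, HasExpPairing u z) ∧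
    -- the dual formula over `C₀(ℝ)`, with a finite supremum
    (dualValues γ).Nonempty ∧ BddAbove (dualValues γ) ∧
    primalInf γ =
      4 * (γ - 2) ^ (γ - 2) / ((2 * Real.pi) ^ (γ - 2) * γ ^ γ) * sSup (dualValues γ) := by
  obtain ⟨⟨m, hm⟩, hdual⟩ := exists_isPrimalMinimizer hγ
  refine ⟨⟨⟨m, hm.1, hm.2⟩, ?_⟩, ⟨m, hm⟩, fun m hm m' => isPrimalMinimizer_iff hγ hm m', ?_,
    dualValues_nonempty hγ, bddAbove_dualValues hγ, hdual⟩
  · rintro _ ⟨m', hm', rfl⟩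
    exact primalInf_le hm'
  · intro g u hu
    exact ⟨_, hasExpPairing_expPairing hu hm.1,
      fun z hz => hz.unique (hasExpPairing_expPairing hu hm.1)⟩
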